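/- Let $n\ge 0$ and consider a convex $(n+3)$-gon. A \emph{diagonal} is a segment joining two non-adjacent vertices; two diagonals \emph{cross} if they are distinct and their relative interiors meet. A \emph{triangulation} is an inclusion-maximal set of pairwise non-crossing diagonals. Fix a triangulation $T_0$ (the seed), with diagonals $\delta_1,\dots,\delta_n$, and a basis $\alpha_1,\dots,\alpha_n$ of a real vector space $V$, where $\alpha_i$ corresponds to $\delta_i$. To each diagonal $d$ of the polygon assign the vector $$v_d=\begin{cases}-\alpha_i & \text{if } d=\delta_i\in T_0,\\[2pt] \displaystyle\sum_{i\,:\; d\text{ crosses }\delta_i}\alpha_i & \text{if } d\notin T_0,\end{cases}$$ and for a triangulation $T$ let $\mathbb{R}_{\ge 0}T\subset V$ be the cone generated by the vectors $v_d$, $d\in T$. Then, for every triangulation $T$, the vectors $v_d$ $(d\in T)$ are linearly independent and span $V$, so that $\mathbb{R}_{\ge 0}T$ is a full-dimensional simplicial cone; distinct triangulations generate distinct cones; and the family $\mathcal F_{T_0}$ of all faces of the cones $\mathbb{R}_{\ge 0}T$, with $T$ ranging over all triangulations of the $(n+3)$-gon, is a complete simplicial fan in $V$. That is: $\mathcal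 F_{T_0}$ is a finite family of finitely generated cones, closed under taking faces; any two of its cones intersect in a common face of both; each of its cones is generated by a linearly independent set of vectors; and the union of its cones is $V$. -/

import Mathlib

/-- The diagonals of a convex `(n+3)`-gon with vertices `0, 1, …, n+2` in cyclic order.
A diagonal is an unordered pair of distinct non-adjacent vertices; it is written with its smaller
endpoint first. The adjacent pairs are `{i, i+1}` and `{0, n+2}`. -/
def PolygonDiagonal (n : ℕ) : Type :=
  {p : Fin (n + 3) × Fin (n + 3) //
    (p.1 : ℕ) + 1 < (p.2 : ℕ) ∧ ¬ ((p.1 : ℕ) = 0 ∧ (p.2 : ℕ) = n + 2)}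

namespace PolygonDiagonal

variable {n : ℕ}

instance : DecidableEq (PolygonDiagonal n) :=
  inferInstanceAs (DecidableEq {p : Fin (n + 3) × Fin (n + 3) //
    (p.1 : ℕ) + 1 < (p.2 : ℕ) ∧ ¬ ((p.1 : ℕ) = 0 ∧ (p.2 : ℕ) = n + 2)})

instance : Fintype (PolygonDiagonal n) :=
  inferInstanceAs (Fintype {p : Fin (n + 3) × Fin (n + 3) //
    (p.1 : ℕ) + 1 < (p.2 : ℕ) ∧ ¬ ((p.1 : ℕ) = 0 ∧ (p.2 : ℕ) = n + 2)})

/-- The smaller endpoint. -/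
def lo (d : PolygonDiagonal n) : Fin (n + 3) := d.1.1

/-- The larger endpoint. -/
def hi (d : PolygonDiagonal n) : Fin (n + 3) := d.1.2

/-- Two diagonals of a convex polygon cross (meet in their relative interiors, without being
equal) if and only if their four endpoints are distinct and alternate in the cyclic order. -/
def Crosses (d e : PolygonDiagonal n) : Prop :=
  (d.lo < e.lo ∧ e.lo < d.hi ∧ d.hi < e.hi) ∨ (e.lo < d.lo ∧ d.lo < e.hi ∧ e.hi < d.hi)

instance (d e : PolygonDiagonal n) : Decidable (Crosses d e) := by
  unfold Crosses; infer_instance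

/-- A set of pairwise non-crossing diagonals. -/
def NonCrossing (T : Finset (PolygonDiagonal n)) : Prop :=
  ∀ d ∈ T, ∀ e ∈ T, ¬ Crosses d e

/-- A triangulation of the convex `(n+3)`-gon, given by its set of diagonals: an inclusion-maximal
set of pairwise non-crossing diagonals. -/
def IsTriangulation (T : Finset (PolygonDiagonal n)) : Prop :=
  Maximal NonCrossing T

variable {V : Type*} [AddCommGroup V] [Module ℝ V]

/-- The vector attached to a diagonal `d` by the seed `T₀` and a basis `α` indexed by the diagonals
of `T₀`: it is `-α_d` if `d ∈ T₀`, and otherwise the sum of the `α_δ` over all `δ ∈ T₀` that `d`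
crosses. -/
noncomputable def vec {T₀ : Finset (PolygonDiagonal n)} (α : Module.Basis T₀ ℝ V)
    (d : PolygonDiagonal n) : V :=
  if h : d ∈ T₀ then -α ⟨d, h⟩
  else ∑ δ : T₀ with Crosses d δ.1, α δ

/-- The cone `ℝ_{≥0} T` generated by the vectors of the diagonals in `T`. -/
noncomputable def cone {T₀ : Finset (PolygonDiagonal n)} (α : Module.Basis T₀ ℝ V)
    (T : Finset (PolygonDiagonal n)) : PointedCone ℝ V :=
  PointedCone.hull ℝ (vec α '' (T : Set (PolygonDiagonal n)))

/-- The family of all faces of all the cones `ℝ_{≥0} T`, for `T` a triangulation. -/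
def seedFan {T₀ : Finset (PolygonDiagonal n)} (α : Module.Basis T₀ ℝ V) :
    Set (PointedCone ℝ V) :=
  {F | ∃ T : Finset (PolygonDiagonal n), IsTriangulation T ∧ F.IsFaceOf (cone α T)}

end PolygonDiagonal

/-- A fan in a real vector space: a finite family of polyhedral (finitely generated) cones that
contains every face of each of its members, and in which any two members intersect in a common
face. -/
structure IsFan {V : Type*} [AddCommGroup V] [Module ℝ V]
    (𝓕 : Set (PointedCone ℝ V)) : Prop where
  finite : 𝓕.Finite
  fg : ∀ C ∈ 𝓕, Submodule.FG C
  face_mem : ∀ C ∈ 𝓕, ∀ F : PointedCone ℝ V, F.IsFaceOf C → F ∈ 𝓕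
  inter_face : ∀ C ∈ 𝓕, ∀ D ∈ 𝓕, (C ⊓ D).IsFaceOf C ∧ (C ⊓ D).IsFaceOf D

/-- A complete simplicial fan: every cone is generated by linearly independent vectors, and the
cones cover the whole space. -/
structure IsCompleteSimplicialFan {V : Type*} [AddCommGroup V] [Module ℝ V]
    (𝓕 : Set (PointedCone ℝ V)) : Prop where
  isFan : IsFan 𝓕
  simplicial : ∀ C ∈ 𝓕, C.IsSimplicial
  complete : ∀ x : V, ∃ C ∈ 𝓕, x ∈ C

/-! Take a nonnegative combination of the vectors of pairwise non-crossing diagonals. Its coordinate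
at `δ ∈ T₀` is the total weight off `T₀` that crosses `δ`, minus the weight of `δ` itself.
Non-crossing prevents both from being positive, so they are the positive and negative parts of the
coordinate. It therefore suffices that every nonnegative function on `T₀` is the crossing function
of exactly one lamination, a nonnegative weight on pairwise non-crossing diagonals outside `T₀`.
Every vector then has exactly one compatible expansion, and independence, faces, intersections and
completeness follow formally.

Uniqueness (`IsLamination.eq_of_crossNum_eq`): in a triangle of `T₀`, the crossing numbers of the
sides determine how much weight cuts off each corner and how much leaves each vertex through the
opposite side. Two distinct laminations with equal crossing numbers may be assumed to have disjoint
supports; a shortest diagonal occurring in either then meets some triangle of `T₀` in a way the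
other lamination cannot match.

Existence (`IsTriangulation.exists_isLamination`): flips of the seed diagonals give some weight with
the prescribed crossing numbers, possibly with crossings. Among such weights, minimise an energy
built from a strictly concave function of chord length. A crossing pair of positive weight could be
exchanged for sides of its quadrilateral, keeping all crossing numbers with `T₀` and lowering the
energy (`exists_resolves`), so a minimiser is a lamination. -/

namespace PolygonDiagonal

/-! ### Chords and the triangles of a triangulation -/

variable {n : ℕ}

/-- `x` lies strictly between `a` and `b`. -/
def Between (a b x : ℕ) : Prop := (a < x ∧ x < b) ∨ (b < x ∧ x < a)

/-- The chords `ab` and `xy` of a convex polygon with vertices labelled in cyclic order cross. -/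
def Sep (a b x y : ℕ) : Prop :=
  (Between a b x ∧ ¬ Between a b y ∧ y ≠ a ∧ y ≠ b) ∨
    (Between a b y ∧ ¬ Between a b x ∧ x ≠ a ∧ x ≠ b)

instance (a b x y : ℕ) : Decidable (Sep a b x y) := by
  unfold Sep Between; infer_instance

theorem lo_hi (d : PolygonDiagonal n) :
    (d.lo : ℕ) + 1 < d.hi ∧ (d.hi : ℕ) ≤ n + 2 ∧ ¬ ((d.lo : ℕ) = 0 ∧ (d.hi : ℕ) = n + 2) :=
  ⟨d.2.1, by have := d.hi.2; omega, d.2.2⟩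

theorem ext_endpoints {d e : PolygonDiagonal n} (h₁ : (d.lo : ℕ) = e.lo)
    (h₂ : (d.hi : ℕ) = e.hi) : d = e :=
  Subtype.ext (Prod.ext (Fin.ext h₁) (Fin.ext h₂))

theorem exists_endpoints {a b : ℕ} (h : a + 1 < b) (hb : b ≤ n + 2)
    (hr : ¬ (a = 0 ∧ b = n + 2)) : ∃ d : PolygonDiagonal n, (d.lo : ℕ) = a ∧ (d.hi : ℕ) = b :=
  ⟨⟨(⟨a, by omega⟩, ⟨b, by omega⟩), h, hr⟩, rfl, rfl⟩

theorem crosses_iff_sep (d e : PolygonDiagonal n) :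
    Crosses d e ↔ Sep d.lo d.hi e.lo e.hi := by
  have := lo_hi d
  have := lo_hi e
  simp only [Crosses, Sep, Between, Fin.lt_def]
  omega

theorem crosses_comm {d e : PolygonDiagonal n} : Crosses d e ↔ Crosses e d := by
  unfold Crosses; tauto

theorem not_crosses_self (d : PolygonDiagonal n) : ¬ Crosses d d := by
  unfold Crosses; simp

/-- `ab`, with `a < b`, is a side of the polygon or a diagonal in `T`. -/
def Edge (T : Finset (PolygonDiagonal n)) (a b : ℕ) : Prop :=
  a < b ∧ b ≤ n + 2 ∧ (b = a + 1 ∨ (a = 0 ∧ b = n + 2) ∨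
    ∃ d ∈ T, (d.lo : ℕ) = a ∧ (d.hi : ℕ) = b)

/-- `ab` is a side of the polygon or a diagonal in `T`, the endpoints being in either order. -/
def SEdge (T : Finset (PolygonDiagonal n)) (a b : ℕ) : Prop := Edge T a b ∨ Edge T b a

theorem SEdge.symm {T : Finset (PolygonDiagonal n)} {a b : ℕ} (h : SEdge T a b) :
    SEdge T b a := Or.symm h

theorem edge_of_mem {T : Finset (PolygonDiagonal n)} {d : PolygonDiagonal n} (hd : d ∈ T) :
    Edge T d.lo d.hi := by
  have := lo_hi d
  exact ⟨by omega, by omega, Or.inr (Or.inr ⟨d, hd, rfl, rfl⟩)⟩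

theorem mem_of_edge {T : Finset (PolygonDiagonal n)} {d : PolygonDiagonal n}
    (h : Edge T d.lo d.hi) : d ∈ T := by
  have := lo_hi d
  obtain ⟨_, _, h | h | ⟨e, he, h₁, h₂⟩⟩ := h
  · omega
  · omega
  · exact ext_endpoints h₁ h₂ ▸ he

theorem NonCrossing.edge_not_sep {T : Finset (PolygonDiagonal n)} (hT : NonCrossing T)
    {a b x y : ℕ} (h : Edge T a b) (h' : Edge T x y) : ¬ Sep a b x y := by
  obtain ⟨h1, h2, h3⟩ := h
  obtain ⟨h1', h2', h3'⟩ := h'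
  by_cases hab : b = a + 1 ∨ (a = 0 ∧ b = n + 2)
  · unfold Sep Between; omega
  by_cases hxy : y = x + 1 ∨ (x = 0 ∧ y = n + 2)
  · unfold Sep Between; omega
  obtain ⟨d, hd, rfl, rfl⟩ : ∃ d ∈ T, (d.lo : ℕ) = a ∧ (d.hi : ℕ) = b := by tauto
  obtain ⟨e, he, rfl, rfl⟩ : ∃ d ∈ T, (d.lo : ℕ) = x ∧ (d.hi : ℕ) = y := by tauto
  rw [← crosses_iff_sep]
  exact hT d hd e he

theorem IsTriangulation.mem_of_not_crosses {T : Finset (PolygonDiagonal n)}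
    (hT : IsTriangulation T) {d : PolygonDiagonal n} (h : ∀ e ∈ T, ¬ Crosses d e) : d ∈ T := by
  have hn : NonCrossing (insert d T) := by
    intro x hx y hy
    rw [Finset.mem_insert] at hx hy
    rcases hx with rfl | hx <;> rcases hy with rfl | hy
    · exact not_crosses_self _
    · exact h y hy
    · rw [crosses_comm]; exact h x hx
    · exact hT.prop x hx y hy
  exact hT.le_of_ge hn (Finset.subset_insert d T) (Finset.mem_insert_self d T)

theorem IsTriangulation.edge_of_not_sep {T : Finset (PolygonDiagonal n)}
    (hT : IsTriangulation T) {a b : ℕ} (hab : a < b) (hb : b ≤ n + 2)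
    (h : ∀ x y, Edge T x y → ¬ Sep a b x y) : Edge T a b := by
  refine ⟨hab, hb, ?_⟩
  by_cases h1 : b = a + 1
  · exact Or.inl h1
  by_cases h2 : a = 0 ∧ b = n + 2
  · exact Or.inr (Or.inl h2)
  obtain ⟨d, hd1, hd2⟩ := exists_endpoints (n := n) (a := a) (b := b) (by omega) hb h2
  refine Or.inr (Or.inr ⟨d, hT.mem_of_not_crosses fun e he => ?_, hd1, hd2⟩)
  rw [crosses_iff_sep, hd1, hd2]
  exact h _ _ (edge_of_mem he)

theorem IsTriangulation.exists_inner_apex {T : Finset (PolygonDiagonal n)}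
    (hT : IsTriangulation T) {a b : ℕ} (hab : Edge T a b) (h : a + 1 < b) :
    ∃ z, Edge T a z ∧ Edge T z b := by
  classical
  have hb := hab.2.1
  obtain ⟨z, ⟨hz, hzb⟩, hmax⟩ : ∃ z, (Edge T a z ∧ z < b) ∧
      ∀ w, Edge T a w ∧ w < b → w ≤ z := by
    have h0 : Edge T a (a + 1) := ⟨by omega, by omega, Or.inl rfl⟩
    exact ⟨Nat.findGreatest (fun z => Edge T a z ∧ z < b) b,
      Nat.findGreatest_spec (P := fun z => Edge T a z ∧ z < b) h.le ⟨h0, h⟩,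
      fun w hw => Nat.le_findGreatest hw.2.le hw⟩
  -- An edge crossing `zb` but neither `ab` nor `az` must run from `a` to a vertex strictly between
  -- `z` and `b`, against the maximality of `z`.
  refine ⟨z, hz, hT.edge_of_not_sep hzb hb fun x y hxy hs => ?_⟩
  have h1 := hT.prop.edge_not_sep hab hxy
  have h2 := hT.prop.edge_not_sep hz hxy
  have h3 : x = a → y < b → y ≤ z := by
    rintro rfl hy
    exact hmax y ⟨hxy, hy⟩
  have := hxy.1
  have := hz.1
  unfold Sep Between at *
  omega

/-- The required triangle is the inner one on the shortest edge properly enclosing `ab`: minimality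
forces `ab` to be one of its sides. The side from `0` to `n + 2` guarantees that an enclosing edge
exists. -/
theorem IsTriangulation.exists_outer_apex {T : Finset (PolygonDiagonal n)}
    (hT : IsTriangulation T) {a b : ℕ} (hab : Edge T a b) (h : ¬ (a = 0 ∧ b = n + 2)) :
    ∃ z, (Edge T z a ∧ Edge T z b) ∨ (Edge T a z ∧ Edge T b z) := by
  classical
  have hab1 := hab.1
  have hb := hab.2.1
  have hex : ∃ m, ∃ c e, Edge T c e ∧ c ≤ a ∧ b ≤ e ∧ ¬ (c = a ∧ b = e) ∧ e = c + m :=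
    ⟨n + 2, 0, n + 2, ⟨by omega, le_rfl, by omega⟩, by omega, by omega, by omega, by omega⟩
  obtain ⟨c, e, hce, h1, h2, h3, h4⟩ := Nat.find_spec hex
  have hmin : ∀ c' e', Edge T c' e' → c' ≤ a → b ≤ e' → ¬ (c' = a ∧ b = e') →
      e' - c' < e - c → False := by
    intro c' e' h5 h6 h7 h8 h9
    refine Nat.find_min hex (m := e' - c') (by omega) ⟨c', e', h5, h6, h7, h8, ?_⟩
    have := h5.1
    omega
  obtain ⟨z, hz1, hz2⟩ := hT.exists_inner_apex hce (by omega)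
  have h5 := hT.prop.edge_not_sep hz1 hab
  have h6 := hT.prop.edge_not_sep hz2 hab
  have h7 := hz1.1
  have h8 := hz2.1
  have h9 : z ≤ a ∨ b ≤ z := by
    unfold Sep Between at *
    omega
  rcases h9 with h9 | h9
  · have h10 : z = a ∧ b = e := by
      by_contra hne
      exact hmin z e hz2 h9 h2 hne (by omega)
    obtain ⟨rfl, rfl⟩ := h10
    exact ⟨c, Or.inl ⟨hz1, hce⟩⟩
  · have h10 : c = a ∧ b = z := by
      by_contra hne
      exact hmin c z hz1 h1 h9 hne (by omega)
    obtain ⟨rfl, rfl⟩ := h10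
    exact ⟨e, Or.inr ⟨hce, hz2⟩⟩

/-- If the vertices of the polygon are divided into three arcs, some triangle of a triangulation
has a vertex in each arc. -/
theorem IsTriangulation.exists_rainbow_triangle {T : Finset (PolygonDiagonal n)}
    (hT : IsTriangulation T) {i j k : ℕ} (hij : i < j) (hjk : j < k) (hk : k ≤ n + 3)
    (hik : 0 < i ∨ k ≤ n + 2) :
    ∃ x y z, (i ≤ x ∧ x < j) ∧ (j ≤ y ∧ y < k) ∧ (z < i ∨ k ≤ z) ∧
      SEdge T x y ∧ SEdge T y z ∧ SEdge T x z := by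
  classical
  have hex : ∃ m, ∃ x y, Edge T x y ∧ (i ≤ x ∧ x < j) ∧ (j ≤ y ∧ y < k) ∧
      m = n + 2 - (y - x) :=
    ⟨_, j - 1, j, ⟨by omega, by omega, by omega⟩, by omega, by omega, rfl⟩
  -- The least `m` gives the longest edge between the first two arcs. Its outer apex is in the third
  -- arc, since otherwise one of the new sides would be a longer such edge.
  obtain ⟨x, y, hxy, hx, hy, hm⟩ := Nat.find_spec hex
  have hmax : ∀ x' y', Edge T x' y' → (i ≤ x' ∧ x' < j) → (j ≤ y' ∧ y' < k) →
      y - x < y' - x' → False := by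
    intro x' y' h1 h2 h3 h4
    have := h1.2.1
    exact Nat.find_min hex (m := n + 2 - (y' - x')) (by omega) ⟨x', y', h1, h2, h3, rfl⟩
  obtain ⟨z, ⟨h1, h2⟩ | ⟨h1, h2⟩⟩ := hT.exists_outer_apex hxy (by omega)
  · have := h1.1
    refine ⟨x, y, z, hx, hy, Or.inl ?_, Or.inl hxy, Or.inr h2, Or.inr h1⟩
    by_contra hz
    exact hmax z y h2 (by omega) hy (by omega)
  · have := h2.1
    refine ⟨x, y, z, hx, hy, Or.inr ?_, Or.inl hxy, Or.inl h2, Or.inl h1⟩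
    by_contra hz
    exact hmax x z h1 hx (by omega) (by omega)

theorem sep_iff_of_lt {a b x y : ℕ} (h : a < b) :
    Sep a b x y ↔ (a < x ∧ x < b ∧ (y < a ∨ b < y)) ∨ (a < y ∧ y < b ∧ (x < a ∨ b < x)) := by
  unfold Sep Between
  omega

theorem sep_lo_hi {d : PolygonDiagonal n} {x y : ℕ} :
    Sep d.lo d.hi x y ↔ ((d.lo : ℕ) < x ∧ x < d.hi ∧ (y < d.lo ∨ (d.hi : ℕ) < y)) ∨
      ((d.lo : ℕ) < y ∧ y < d.hi ∧ (x < d.lo ∨ (d.hi : ℕ) < x)) :=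
  sep_iff_of_lt (by have := lo_hi d; omega)

theorem sep_comm {a b x y : ℕ} : Sep a b x y ↔ Sep a b y x := or_comm

/-! ### Laminations and their crossings with a triangle -/

/-- A nonnegative weight on the diagonals, supported on pairwise non-crossing diagonals outside
`T₀`. -/
structure IsLamination (T₀ : Finset (PolygonDiagonal n)) (w : PolygonDiagonal n → ℝ) : Prop where
  nonneg : ∀ d, 0 ≤ w d
  not_crosses : ∀ d e, 0 < w d → 0 < w e → ¬ Crosses d e
  eq_zero_of_mem : ∀ d ∈ T₀, w d = 0

/-- The total weight of the diagonals with property `P`. -/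
noncomputable def weight (w : PolygonDiagonal n → ℝ) (P : PolygonDiagonal n → Prop)
    [DecidablePred P] : ℝ :=
  ∑ d, if P d then w d else 0

/-- The total weight of the diagonals crossing the chord `ab`. -/
noncomputable def crossNum (w : PolygonDiagonal n → ℝ) (a b : ℕ) : ℝ :=
  weight w fun d => Sep d.lo d.hi a b

/-- The total weight of the diagonals crossing both `pq` and `pr`. -/
noncomputable def corner (w : PolygonDiagonal n → ℝ) (p q r : ℕ) : ℝ :=
  weight w fun d => Sep d.lo d.hi p q ∧ Sep d.lo d.hi p r

/-- The total weight of the diagonals ending at `p` and crossing `qr`. -/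
noncomputable def ending (w : PolygonDiagonal n → ℝ) (p q r : ℕ) : ℝ :=
  weight w fun d => ((d.lo : ℕ) = p ∨ (d.hi : ℕ) = p) ∧ Sep d.lo d.hi q r

section weight

variable {w : PolygonDiagonal n → ℝ} {P : PolygonDiagonal n → Prop} [DecidablePred P]

theorem weight_nonneg (hw : ∀ d, 0 ≤ w d) : 0 ≤ weight w P :=
  Finset.sum_nonneg fun d _ => by split_ifs <;> simp [hw d]

theorem weight_pos_iff (hw : ∀ d, 0 ≤ w d) : 0 < weight w P ↔ ∃ d, 0 < w d ∧ P d := by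
  have h0 : ∀ d ∈ Finset.univ, 0 ≤ if P d then w d else 0 := fun d _ => by
    split_ifs <;> simp [hw d]
  rw [weight, Finset.sum_pos_iff_of_nonneg h0]
  constructor
  · rintro ⟨d, _, hd⟩
    by_cases h : P d
    · exact ⟨d, by simpa [h] using hd, h⟩
    · simp [h] at hd
  · rintro ⟨d, hd, h⟩
    exact ⟨d, Finset.mem_univ d, by simpa [h] using hd⟩

end weight

theorem crossNum_comm (w : PolygonDiagonal n → ℝ) (a b : ℕ) : crossNum w a b = crossNum w b a :=
  Finset.sum_congr rfl fun _ _ => if_congr sep_comm rfl rfl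

theorem corner_comm (w : PolygonDiagonal n → ℝ) (p q r : ℕ) : corner w p q r = corner w p r q :=
  Finset.sum_congr rfl fun _ _ => if_congr and_comm rfl rfl

theorem ending_comm (w : PolygonDiagonal n → ℝ) (p q r : ℕ) : ending w p q r = ending w p r q :=
  Finset.sum_congr rfl fun _ _ => if_congr (and_congr_right fun _ => sep_comm) rfl rfl

/-- A diagonal crossing `qr` leaves the triangle `pqr` in exactly one way: through `pq`, through
`pr`, or at `p`. -/
theorem crossNum_eq_add (w : PolygonDiagonal n → ℝ) (p q r : ℕ) :
    crossNum w q r = corner w q p r + corner w r p q + ending w p q r := by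
  simp only [crossNum, corner, ending, weight, ← Finset.sum_add_distrib]
  refine Finset.sum_congr rfl fun d _ => ?_
  have hd := lo_hi d
  generalize w d = c
  by_cases h : Sep d.lo d.hi q r
  · have h' : Sep d.lo d.hi r q := sep_comm.1 h
    simp only [h, h', and_true, if_true]
    have : (Sep d.lo d.hi q p ∧ ¬ Sep d.lo d.hi r p ∧ ¬ ((d.lo : ℕ) = p ∨ (d.hi : ℕ) = p)) ∨
        (¬ Sep d.lo d.hi q p ∧ Sep d.lo d.hi r p ∧ ¬ ((d.lo : ℕ) = p ∨ (d.hi : ℕ) = p)) ∨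
        (¬ Sep d.lo d.hi q p ∧ ¬ Sep d.lo d.hi r p ∧ ((d.lo : ℕ) = p ∨ (d.hi : ℕ) = p)) := by
      simp only [sep_lo_hi] at h ⊢
      clear h'
      omega
    rcases this with ⟨h1, h2, h3⟩ | ⟨h1, h2, h3⟩ | ⟨h1, h2, h3⟩
    · rw [if_pos h1, if_neg h2, if_neg h3]; ring
    · rw [if_neg h1, if_pos h2, if_neg h3]; ring
    · rw [if_neg h1, if_neg h2, if_pos h3]; ring
  · have h' : ¬ Sep d.lo d.hi r q := fun hs => h (sep_comm.1 hs)
    simp [h, h']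

/-- A diagonal from `p` through `qr` separates `q` from `r`, and so crosses every diagonal that cuts
off `p` or that leaves `q` or `r` through the opposite side. -/
theorem IsLamination.ending_pos {T₀ : Finset (PolygonDiagonal n)} {w : PolygonDiagonal n → ℝ}
    (hw : IsLamination T₀ w) {p q r : ℕ} (h : 0 < ending w p q r) :
    corner w p q r = 0 ∧ ending w q p r = 0 ∧ ending w r p q = 0 := by
  obtain ⟨d, hd, hd1, hd2⟩ := (weight_pos_iff hw.nonneg).1 h
  have hdl := lo_hi d
  have key : ∀ P : PolygonDiagonal n → Prop, ∀ [DecidablePred P],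
      (∀ e, P e → Sep d.lo d.hi e.lo e.hi) → weight w P = 0 := by
    intro P _ hP
    refine le_antisymm (not_lt.1 fun hlt => ?_) (weight_nonneg hw.nonneg)
    obtain ⟨e, he, hPe⟩ := (weight_pos_iff hw.nonneg).1 hlt
    exact hw.not_crosses d e hd he ((crosses_iff_sep d e).2 (hP e hPe))
  rw [sep_lo_hi] at hd2
  refine ⟨key _ fun e he => ?_, key _ fun e he => ?_, key _ fun e he => ?_⟩ <;>
  · have hel := lo_hi e
    simp only [sep_lo_hi] at he ⊢
    rcases hd1 with rfl | rfl <;> omega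

/-- Write `sᵢ` for the three sums. At most one `eᵢ` is positive, and then `yᵢ = 0`. If all `eᵢ`
vanish, `y₁ = (s₂ + s₃ - s₁) / 2` and its analogues hold; a positive `e₁` equals `s₁ - s₂ - s₃`, the
failure of the triangle inequality. -/
theorem corner_ending_eq_of_sums_eq {y₁ y₂ y₃ e₁ e₂ e₃ y₁' y₂' y₃' e₁' e₂' e₃' : ℝ}
    (hy₁ : 0 ≤ y₁) (hy₂ : 0 ≤ y₂) (hy₃ : 0 ≤ y₃) (he₁ : 0 ≤ e₁) (he₂ : 0 ≤ e₂) (he₃ : 0 ≤ e₃)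
    (hy₁' : 0 ≤ y₁') (hy₂' : 0 ≤ y₂') (hy₃' : 0 ≤ y₃')
    (he₁' : 0 ≤ e₁') (he₂' : 0 ≤ e₂') (he₃' : 0 ≤ e₃')
    (h₁ : 0 < e₁ → y₁ = 0 ∧ e₂ = 0 ∧ e₃ = 0) (h₂ : 0 < e₂ → y₂ = 0 ∧ e₁ = 0 ∧ e₃ = 0)
    (h₃ : 0 < e₃ → y₃ = 0 ∧ e₁ = 0 ∧ e₂ = 0)
    (h₁' : 0 < e₁' → y₁' = 0 ∧ e₂' = 0 ∧ e₃' = 0) (h₂' : 0 < e₂' → y₂' = 0 ∧ e₁' = 0 ∧ e₃' = 0)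
    (h₃' : 0 < e₃' → y₃' = 0 ∧ e₁' = 0 ∧ e₂' = 0)
    (s₁ : y₂ + y₃ + e₁ = y₂' + y₃' + e₁') (s₂ : y₁ + y₃ + e₂ = y₁' + y₃' + e₂')
    (s₃ : y₁ + y₂ + e₃ = y₁' + y₂' + e₃') : y₁ = y₁' ∧ e₁ = e₁' := by
  have c : (e₁ = 0 ∧ e₂ = 0 ∧ e₃ = 0) ∨ (y₁ = 0 ∧ e₂ = 0 ∧ e₃ = 0) ∨
      (y₂ = 0 ∧ e₁ = 0 ∧ e₃ = 0) ∨ (y₃ = 0 ∧ e₁ = 0 ∧ e₂ = 0) := by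
    rcases he₁.eq_or_lt with a | a
    · rcases he₂.eq_or_lt with b | b
      · rcases he₃.eq_or_lt with c | c
        · exact Or.inl ⟨a.symm, b.symm, c.symm⟩
        · exact Or.inr (Or.inr (Or.inr (h₃ c)))
      · exact Or.inr (Or.inr (Or.inl (h₂ b)))
    · exact Or.inr (Or.inl (h₁ a))
  have c' : (e₁' = 0 ∧ e₂' = 0 ∧ e₃' = 0) ∨ (y₁' = 0 ∧ e₂' = 0 ∧ e₃' = 0) ∨
      (y₂' = 0 ∧ e₁' = 0 ∧ e₃' = 0) ∨ (y₃' = 0 ∧ e₁' = 0 ∧ e₂' = 0) := by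
    rcases he₁'.eq_or_lt with a | a
    · rcases he₂'.eq_or_lt with b | b
      · rcases he₃'.eq_or_lt with c | c
        · exact Or.inl ⟨a.symm, b.symm, c.symm⟩
        · exact Or.inr (Or.inr (Or.inr (h₃' c)))
      · exact Or.inr (Or.inr (Or.inl (h₂' b)))
    · exact Or.inr (Or.inl (h₁' a))
  rcases c with ⟨a1, a2, a3⟩ | ⟨a1, a2, a3⟩ | ⟨a1, a2, a3⟩ | ⟨a1, a2, a3⟩ <;>
  rcases c' with ⟨b1, b2, b3⟩ | ⟨b1, b2, b3⟩ | ⟨b1, b2, b3⟩ | ⟨b1, b2, b3⟩ <;>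
  constructor <;> linarith

/-! ### A lamination is determined by its crossing numbers -/

section uniqueness

variable {T₀ : Finset (PolygonDiagonal n)} {w w' : PolygonDiagonal n → ℝ}

theorem crossNum_eq_of_sedge
    (h : ∀ δ ∈ T₀, crossNum w δ.lo δ.hi = crossNum w' δ.lo δ.hi) {a b : ℕ} (hab : SEdge T₀ a b) :
    crossNum w a b = crossNum w' a b := by
  have key : ∀ a b, Edge T₀ a b → crossNum w a b = crossNum w' a b := by
    rintro a b ⟨h1, h2, h3⟩
    by_cases hs : b = a + 1 ∨ (a = 0 ∧ b = n + 2)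
    · refine Finset.sum_congr rfl fun d _ => ?_
      have hd := lo_hi d
      have : ¬ Sep d.lo d.hi a b := by unfold Sep Between; omega
      simp [this]
    · obtain ⟨d, hd, rfl, rfl⟩ : ∃ d ∈ T₀, (d.lo : ℕ) = a ∧ (d.hi : ℕ) = b := by tauto
      exact h d hd
  rcases hab with hab | hab
  · exact key _ _ hab
  · rw [crossNum_comm w, crossNum_comm w', key _ _ hab]

theorem IsLamination.corner_ending_eq (hw : IsLamination T₀ w) (hw' : IsLamination T₀ w')
    (h : ∀ δ ∈ T₀, crossNum w δ.lo δ.hi = crossNum w' δ.lo δ.hi) {p q r : ℕ}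
    (hpq : SEdge T₀ p q) (hpr : SEdge T₀ p r) (hqr : SEdge T₀ q r) :
    corner w p q r = corner w' p q r ∧ ending w p q r = ending w' p q r := by
  have s1 := crossNum_eq_of_sedge h hqr
  have s2 := crossNum_eq_of_sedge h hpr
  have s3 := crossNum_eq_of_sedge h hpq
  rw [crossNum_eq_add w p q r, crossNum_eq_add w' p q r] at s1
  rw [crossNum_eq_add w q p r, crossNum_eq_add w' q p r] at s2
  rw [crossNum_eq_add w r p q, crossNum_eq_add w' r p q] at s3
  rw [corner_comm w r q p, corner_comm w' r q p, corner_comm w p q r, corner_comm w' p q r] at s2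
  rw [corner_comm w p r q, corner_comm w' p r q, corner_comm w q r p, corner_comm w' q r p] at s3
  have nn := fun P [DecidablePred P] => weight_nonneg (P := P) hw.nonneg
  have nn' := fun P [DecidablePred P] => weight_nonneg (P := P) hw'.nonneg
  have E := hw.ending_pos (p := p) (q := q) (r := r)
  have E2 := hw.ending_pos (p := q) (q := p) (r := r)
  have E3 := hw.ending_pos (p := r) (q := p) (r := q)
  have E' := hw'.ending_pos (p := p) (q := q) (r := r)
  have E2' := hw'.ending_pos (p := q) (q := p) (r := r)
  have E3' := hw'.ending_pos (p := r) (q := p) (r := q)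
  rw [ending_comm w p r q, ending_comm w q r p] at E3
  rw [ending_comm w' p r q, ending_comm w' q r p] at E3'
  rw [ending_comm w r q p] at E2
  rw [ending_comm w' r q p] at E2'
  rw [corner_comm w p r q, corner_comm w' p r q] at s2
  exact corner_ending_eq_of_sums_eq (nn _) (nn _) (nn _) (nn _) (nn _) (nn _)
    (nn' _) (nn' _) (nn' _) (nn' _) (nn' _) (nn' _) E E2 E3 E' E2' E3' s1 s2 s3

/-- Since `d` is not in `T₀`, it leaves `a` through the opposite side of some triangle of `T₀` at
`a`. The weight doing so is the same for `w'`. The triangle is the rainbow triangle in which `a`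
alone forms one of the three arcs. -/
theorem IsLamination.exists_ending (hT₀ : IsTriangulation T₀) (hw : IsLamination T₀ w)
    (hw' : IsLamination T₀ w')
    (h : ∀ δ ∈ T₀, crossNum w δ.lo δ.hi = crossNum w' δ.lo δ.hi) {d : PolygonDiagonal n}
    (hd : 0 < w d) {a : ℕ} (ha : (d.lo : ℕ) = a ∨ (d.hi : ℕ) = a) :
    ∃ e, 0 < w' e ∧ ((e.lo : ℕ) = a ∨ (e.hi : ℕ) = a) := by
  have hdl := lo_hi d
  have hne : ¬ SEdge T₀ d.lo d.hi := by
    rintro (hs | hs)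
    · exact hd.ne' (hw.eq_zero_of_mem d (mem_of_edge hs))
    · have := hs.1; omega
  have key : ∀ y z, SEdge T₀ a y → SEdge T₀ a z → SEdge T₀ y z → Sep d.lo d.hi y z →
      ∃ e, 0 < w' e ∧ ((e.lo : ℕ) = a ∨ (e.hi : ℕ) = a) := by
    intro y z h1 h2 h3 h4
    have h5 : 0 < ending w a y z := (weight_pos_iff hw.nonneg).2 ⟨d, hd, ha, h4⟩
    rw [(hw.corner_ending_eq hw' h h1 h2 h3).2] at h5
    obtain ⟨e, he, he', _⟩ := (weight_pos_iff hw'.nonneg).1 h5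
    exact ⟨e, he, he'⟩
  rcases ha with rfl | rfl
  · obtain ⟨x, y, z, hx, hy, hz, hxy, hyz, hxz⟩ := hT₀.exists_rainbow_triangle
      (i := d.lo) (j := d.lo + 1) (k := d.hi + 1) (by omega) (by omega) (by omega) (by omega)
    obtain rfl : x = d.lo := by omega
    have hyb : y ≠ d.hi := by rintro rfl; exact hne hxy
    exact key y z hxy hxz hyz (by unfold Sep Between; omega)
  · obtain ⟨x, y, z, hx, hy, hz, hxy, hyz, hxz⟩ := hT₀.exists_rainbow_triangle
      (i := d.lo + 1) (j := d.hi) (k := d.hi + 1) (by omega) (by omega) (by omega) (by omega)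
    obtain rfl : y = d.hi := by omega
    have hyb : z ≠ d.lo := by rintro rfl; exact hne hyz.symm
    exact key x z hxy.symm hyz hxz (by unfold Sep Between; omega)

/-- A triangle of `T₀` is found through which `d` passes, while no diagonal in the support of `w'`
can pass in the same way, although the corner and ending weights there agree. -/
theorem IsLamination.not_disjoint (hT₀ : IsTriangulation T₀) (hw : IsLamination T₀ w)
    (hw' : IsLamination T₀ w')
    (h : ∀ δ ∈ T₀, crossNum w δ.lo δ.hi = crossNum w' δ.lo δ.hi) {d : PolygonDiagonal n}
    (hd : 0 < w d) (hd' : w' d = 0)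
    (hmin : ∀ e, 0 < w e ∨ 0 < w' e → (d.hi : ℕ) - d.lo ≤ e.hi - e.lo) : False := by
  have hdl := lo_hi d
  have hne : ¬ SEdge T₀ d.lo d.hi := by
    rintro (hs | hs)
    · exact hd.ne' (hw.eq_zero_of_mem d (mem_of_edge hs))
    · have := hs.1; omega
  obtain ⟨s, hs⟩ : ∃ s : ℕ, s = d.lo := ⟨_, rfl⟩
  obtain ⟨t, ht⟩ : ∃ t : ℕ, t = d.hi := ⟨_, rfl⟩
  have hdst : ∀ {a b}, Sep s t a b → Sep d.lo d.hi a b := by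
    intro a b; rw [hs, ht]; exact id
  rw [← hs, ← ht] at hne hmin hdl
  -- A diagonal of `w'` ending strictly between `s` and `t` would force one of `w` to end there; as
  -- that one does not cross `d`, it would be shorter than `d`.
  have hends : ∀ e, 0 < w' e → ¬ ((s < e.lo ∧ (e.lo : ℕ) < t) ∨ (s < e.hi ∧ (e.hi : ℕ) < t)) := by
    have key : ∀ a, s < a → a < t → ∀ e, 0 < w' e → ((e.lo : ℕ) = a ∨ (e.hi : ℕ) = a) → False := by
      intro a h1 h2 e he hea
      obtain ⟨f, hf, hfa⟩ := hw'.exists_ending hT₀ hw (fun δ hδ => (h δ hδ).symm) he hea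
      have h3 := hmin f (Or.inl hf)
      have h4 := hw.not_crosses d f hd hf
      rw [crosses_iff_sep, ← hs, ← ht] at h4
      have := lo_hi f
      unfold Sep Between at h4
      omega
    rintro e he (⟨h1, h2⟩ | ⟨h1, h2⟩)
    · exact key _ h1 h2 e he (Or.inl rfl)
    · exact key _ h1 h2 e he (Or.inr rfl)
  have hne' : ∀ e, 0 < w' e → ¬ ((e.lo : ℕ) = s ∧ (e.hi : ℕ) = t) := by
    rintro e he ⟨h1, h2⟩
    rw [ext_endpoints (h1.trans hs) (h2.trans ht)] at he
    exact he.ne' hd'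
  -- `key v` is the cyclic distance from `t` forward to `v`. Minimising it picks the first vertex,
  -- from `t` on, that the support of `w'` joins to `s`.
  obtain ⟨key, hkey⟩ : ∃ key : ℕ → ℕ, ∀ v, key v = if t ≤ v then v - t else v + (n + 3) - t :=
    ⟨_, fun _ => rfl⟩
  obtain ⟨v, ⟨f, hf, hfv⟩, hvmin⟩ : ∃ v, (∃ e, 0 < w' e ∧
      (((e.lo : ℕ) = s ∧ (e.hi : ℕ) = v) ∨ ((e.lo : ℕ) = v ∧ (e.hi : ℕ) = s))) ∧
      ∀ u, (∃ e, 0 < w' e ∧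
      (((e.lo : ℕ) = s ∧ (e.hi : ℕ) = u) ∨ ((e.lo : ℕ) = u ∧ (e.hi : ℕ) = s))) →
        key v ≤ key u := by
    classical
    obtain ⟨e, he, hea⟩ := hw.exists_ending hT₀ hw' h hd (Or.inl hs.symm)
    have hex : ∃ m v, key v = m ∧ ∃ e, 0 < w' e ∧
        (((e.lo : ℕ) = s ∧ (e.hi : ℕ) = v) ∨ ((e.lo : ℕ) = v ∧ (e.hi : ℕ) = s)) := by
      rcases hea with hea | hea
      · exact ⟨_, e.hi, rfl, e, he, Or.inl ⟨hea, rfl⟩⟩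
      · exact ⟨_, e.lo, rfl, e, he, Or.inr ⟨rfl, hea⟩⟩
    obtain ⟨v, hv, hve⟩ := Nat.find_spec hex
    exact ⟨v, hve, fun u hu => hv ▸ Nat.find_min' hex ⟨u, rfl, hu⟩⟩
  have hfl := lo_hi f
  have hf1 := hends f hf
  have hf2 := hne' f hf
  have hfacts : ∀ e, 0 < w' e →
      (s < v → ¬ ((s < e.lo ∧ (e.lo : ℕ) < v ∧ v < e.hi) ∨
        ((e.lo : ℕ) < s ∧ s < e.hi ∧ (e.hi : ℕ) < v))) ∧
      (v < s → ¬ ((v < e.lo ∧ (e.lo : ℕ) < s ∧ s < e.hi) ∨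
        ((e.lo : ℕ) < v ∧ v < e.hi ∧ (e.hi : ℕ) < s))) ∧
      ((e.lo : ℕ) = s → (t ≤ e.hi → t ≤ v ∧ v ≤ e.hi) ∧ ((e.hi : ℕ) < t → t ≤ v ∨ v ≤ e.hi)) ∧
      ((e.hi : ℕ) = s → (t ≤ e.lo → t ≤ v ∧ v ≤ e.lo) ∧ ((e.lo : ℕ) < t → t ≤ v ∨ v ≤ e.lo)) := by
    intro e he
    have hel := lo_hi e
    have h0 := hw'.not_crosses f e hf he
    rw [crosses_iff_sep, sep_lo_hi] at h0
    refine ⟨fun h1 => by omega, fun h1 => by omega, fun h1 => ?_, fun h1 => ?_⟩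
    · have := hvmin (e.hi : ℕ) ⟨e, he, Or.inl ⟨h1, rfl⟩⟩
      rw [hkey, hkey] at this
      split_ifs at this <;> omega
    · have := hvmin (e.lo : ℕ) ⟨e, he, Or.inr ⟨rfl, h1⟩⟩
      rw [hkey, hkey] at this
      split_ifs at this <;> omega
  -- Cyclically, `q`, `y`, `r` lie in the arcs `(s,t)`, `[t,v]`, `(v,s]`. The diagonal `st` ends at
  -- `r = s`, ends at `y = t`, or cuts off the corner `q`. A diagonal of `w'` of the same type, with
  -- no end in `(s,t)` and different from `st`, would cross `f = sv` or join `s` to a vertex before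
  -- `v`.
  have main : ∀ q y r, (s < q ∧ q < t) →
      ((t < v ∧ t ≤ y ∧ y ≤ v ∧ (r ≤ s ∨ v < r)) ∨
        (v < s ∧ (y ≤ v ∨ t ≤ y) ∧ v < r ∧ r ≤ s)) →
      SEdge T₀ q y → SEdge T₀ q r → SEdge T₀ y r → False := by
    intro q y r hq hyr hqy hqr hyr'
    have final : ∀ e, 0 < w' e →
        (((e.lo : ℕ) = s ∨ (e.hi : ℕ) = s) ∧ Sep e.lo e.hi q y) ∨
          (((e.lo : ℕ) = t ∨ (e.hi : ℕ) = t) ∧ Sep e.lo e.hi q r) ∨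
          (Sep e.lo e.hi q y ∧ Sep e.lo e.hi q r) → False := by
      intro e he hsep
      simp only [sep_lo_hi] at hsep
      obtain ⟨h6, h6', h7, h8⟩ := hfacts e he
      have h9 := hends e he
      have h10 := hne' e he
      have hel := lo_hi e
      generalize (e.lo : ℕ) = a at *
      generalize (e.hi : ℕ) = b at *
      clear hfacts hdst hmin hends hne' hkey hvmin hfv hfl hf1 hf2
      rcases hyr with hyr | hyr
      · have h6 := h6 (by omega)
        clear h6'
        rcases hsep with ⟨h11 | h11, h12⟩ | ⟨h11 | h11, h12⟩ | ⟨h11, h12⟩ <;> omega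
      · have h6' := h6' (by omega)
        clear h6
        rcases hsep with ⟨h11 | h11, h12⟩ | ⟨h11 | h11, h12⟩ | ⟨h11, h12⟩ <;> omega
    by_cases hr : r = s
    · by_cases hy : y = t
      · exact hne (hr ▸ hy ▸ hyr'.symm)
      · subst hr
        have h5 : 0 < ending w r q y := (weight_pos_iff hw.nonneg).2
          ⟨d, hd, Or.inl hs.symm, hdst (by unfold Sep Between; omega)⟩
        rw [(hw.corner_ending_eq hw' h hqr.symm hyr'.symm hqy).2] at h5
        obtain ⟨e, he, he1, he2⟩ := (weight_pos_iff hw'.nonneg).1 h5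
        exact final e he (Or.inl ⟨he1, he2⟩)
    · by_cases hy : y = t
      · subst hy
        have h5 : 0 < ending w y q r := (weight_pos_iff hw.nonneg).2
          ⟨d, hd, Or.inr ht.symm, hdst (by unfold Sep Between; omega)⟩
        rw [(hw.corner_ending_eq hw' h hqy.symm hyr' hqr).2] at h5
        obtain ⟨e, he, he1, he2⟩ := (weight_pos_iff hw'.nonneg).1 h5
        exact final e he (Or.inr (Or.inl ⟨he1, he2⟩))
      · have h5 : 0 < corner w q y r := (weight_pos_iff hw.nonneg).2
          ⟨d, hd, hdst (by unfold Sep Between; omega), hdst (by unfold Sep Between; omega)⟩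
        rw [(hw.corner_ending_eq hw' h hqy hqr hyr').1] at h5
        obtain ⟨e, he, he1, he2⟩ := (weight_pos_iff hw'.nonneg).1 h5
        exact final e he (Or.inr (Or.inr ⟨he1, he2⟩))
  have hv : t < v ∨ v < s := by omega
  rcases hv with hv | hv
  · obtain ⟨x, y, z, hx, hy, hz, hxy, hyz, hxz⟩ := hT₀.exists_rainbow_triangle
      (i := s + 1) (j := t) (k := v + 1) (by omega) (by omega) (by omega) (by omega)
    exact main x y z (by omega) (by omega) hxy hxz hyz
  · obtain ⟨x, y, z, hx, hy, hz, hxy, hyz, hxz⟩ := hT₀.exists_rainbow_triangle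
      (i := v + 1) (j := s + 1) (k := t) (by omega) (by omega) (by omega) (by omega)
    exact main y z x (by omega) (by omega) hyz hxy.symm hxz.symm

end uniqueness

section weight

variable (w w' : PolygonDiagonal n → ℝ) (P : PolygonDiagonal n → Prop) [DecidablePred P]

theorem weight_add : weight (w + w') P = weight w P + weight w' P := by
  simp only [weight, ← Finset.sum_add_distrib]
  refine Finset.sum_congr rfl fun d _ => ?_
  split_ifs <;> simp

theorem weight_sub : weight (w - w') P = weight w P - weight w' P := by
  simp only [weight, ← Finset.sum_sub_distrib]
  refine Finset.sum_congr rfl fun d _ => ?_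
  split_ifs <;> simp

theorem weight_smul (c : ℝ) : weight (c • w) P = c * weight w P := by
  simp only [weight, Finset.mul_sum]
  refine Finset.sum_congr rfl fun d _ => ?_
  split_ifs <;> simp

theorem weight_single (d : PolygonDiagonal n) :
    weight (Pi.single d 1) P = if P d then 1 else 0 := by
  rw [weight, Finset.sum_eq_single d]
  · simp
  · intro e _ he
    simp [he]
  · simp

end weight

/-- Removing the common part `min w w'` preserves equality of crossing numbers and makes the
supports disjoint, so a shortest remaining diagonal contradicts `IsLamination.not_disjoint`. -/
theorem IsLamination.eq_of_crossNum_eq {T₀ : Finset (PolygonDiagonal n)}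
    (hT₀ : IsTriangulation T₀) {w w' : PolygonDiagonal n → ℝ}
    (hw : IsLamination T₀ w) (hw' : IsLamination T₀ w')
    (h : ∀ δ ∈ T₀, crossNum w δ.lo δ.hi = crossNum w' δ.lo δ.hi) : w = w' := by
  set m : PolygonDiagonal n → ℝ := fun d => min (w d) (w' d) with hm
  have key : ∀ u u' : PolygonDiagonal n → ℝ, IsLamination T₀ u → IsLamination T₀ u' →
      IsLamination T₀ (u - fun d => min (u d) (u' d)) := by
    intro u u' hu hu'
    refine ⟨fun d => sub_nonneg.2 (min_le_left _ _), fun d e hd he => ?_, fun d hd => ?_⟩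
    · have h1 : ∀ d, 0 < (u - fun d => min (u d) (u' d)) d → 0 < u d := fun d hd => by
        have := le_min (hu.nonneg d) (hu'.nonneg d)
        simp only [Pi.sub_apply] at hd
        linarith
      exact hu.not_crosses d e (h1 d hd) (h1 e he)
    · simp [hu.eq_zero_of_mem d hd, hu'.eq_zero_of_mem d hd]
  have hv : IsLamination T₀ (w - m) := key w w' hw hw'
  have hv' : IsLamination T₀ (w' - m) := by
    have := key w' w hw' hw
    simp only [min_comm (w' _)] at this
    exact this
  have hvv : ∀ δ ∈ T₀, crossNum (w - m) δ.lo δ.hi = crossNum (w' - m) δ.lo δ.hi := by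
    intro δ hδ
    have := h δ hδ
    simp only [crossNum, weight_sub] at this ⊢
    rw [this]
  have hdisj : ∀ d, (w - m) d = 0 ∨ (w' - m) d = 0 := by
    intro d
    rcases min_choice (w d) (w' d) with h1 | h1
    · left; simp [hm, h1]
    · right; simp [hm, h1]
  by_contra hne
  have hS : (Finset.univ.filter fun d => 0 < (w - m) d ∨ 0 < (w' - m) d).Nonempty := by
    by_contra hS
    rw [Finset.not_nonempty_iff_eq_empty, Finset.filter_eq_empty_iff] at hS
    refine hne (funext fun d => ?_)
    have h1 := hS (Finset.mem_univ d)
    rw [not_or, not_lt, not_lt] at h1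
    have h2 := le_antisymm h1.1 (hv.nonneg d)
    have h3 := le_antisymm h1.2 (hv'.nonneg d)
    simp only [Pi.sub_apply] at h2 h3
    linarith
  obtain ⟨d, hd, hmin⟩ := Finset.exists_min_image _
    (fun d : PolygonDiagonal n => (d.hi : ℕ) - (d.lo : ℕ)) hS
  simp only [Finset.mem_filter, Finset.mem_univ, true_and] at hd hmin
  rcases hd with hd | hd
  · exact hv.not_disjoint hT₀ hv' hvv hd ((hdisj d).resolve_left hd.ne') hmin
  · exact hv'.not_disjoint hT₀ hv (fun δ hδ => (hvv δ hδ).symm) hd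
      ((hdisj d).resolve_right hd.ne') fun e he => hmin e he.symm

/-! ### Chord indicators and the energy -/

/-- The indicator of the chord `ab`; it vanishes if `ab` is a side or belongs to `T₀`. -/
noncomputable def chord (T₀ : Finset (PolygonDiagonal n)) (a b : ℕ) : PolygonDiagonal n → ℝ :=
  fun d => if d ∉ T₀ ∧ (d.lo : ℕ) = a ∧ (d.hi : ℕ) = b then 1 else 0

/-- A strictly concave function of the length of a chord. -/
noncomputable def height (n a b : ℕ) : ℝ := ((b : ℝ) - a) * ((n : ℝ) + 3 - (b - a))

/-- The indicator of the crossing of two chords. -/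
noncomputable def sepInd (a b x y : ℕ) : ℝ := if Sep a b x y then 1 else 0

theorem chord_eq_single {T₀ : Finset (PolygonDiagonal n)} {d : PolygonDiagonal n}
    (hd : d ∉ T₀) : chord T₀ d.lo d.hi = Pi.single d 1 := by
  ext e
  by_cases h : e = d
  · subst h; simp [chord, hd]
  · have : ¬ ((e.lo : ℕ) = d.lo ∧ (e.hi : ℕ) = d.hi) := fun h' => h (ext_endpoints h'.1 h'.2)
    simp [chord, h, this]

theorem chord_eq_zero {T₀ : Finset (PolygonDiagonal n)} {a b : ℕ}
    (h : ∀ d : PolygonDiagonal n, d ∉ T₀ → ¬ ((d.lo : ℕ) = a ∧ (d.hi : ℕ) = b)) :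
    chord T₀ a b = 0 := by
  ext d
  by_cases hd : d ∈ T₀
  · simp [chord, hd]
  · have := h d hd
    simp [chord, this]

theorem chord_nonneg (T₀ : Finset (PolygonDiagonal n)) (a b : ℕ) (d : PolygonDiagonal n) :
    0 ≤ chord T₀ a b d := by
  unfold chord; split_ifs <;> norm_num

theorem chord_eq_zero_of_mem {T₀ : Finset (PolygonDiagonal n)} (a b : ℕ)
    {d : PolygonDiagonal n} (hd : d ∈ T₀) : chord T₀ a b d = 0 := by
  simp [chord, hd]

/-- Setting the indicator to zero on sides and on `T₀` costs nothing, because those chords cross no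
member of `T₀`. -/
theorem crossNum_chord {T₀ : Finset (PolygonDiagonal n)} (hT₀ : NonCrossing T₀) {a b : ℕ}
    (hab : a < b) (hb : b ≤ n + 2) {δ : PolygonDiagonal n} (hδ : δ ∈ T₀) :
    crossNum (chord T₀ a b) δ.lo δ.hi = sepInd a b δ.lo δ.hi := by
  by_cases h : ∃ d : PolygonDiagonal n, d ∉ T₀ ∧ (d.lo : ℕ) = a ∧ (d.hi : ℕ) = b
  · obtain ⟨d, hd, rfl, rfl⟩ := h
    rw [chord_eq_single hd, crossNum, weight_single, sepInd]
  · push Not at h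
    rw [chord_eq_zero fun d hd h' => h d hd h'.1 h'.2, sepInd, if_neg]
    · simp [crossNum, weight]
    · refine hT₀.edge_not_sep ⟨hab, hb, ?_⟩ (edge_of_mem hδ)
      by_contra h1
      push Not at h1
      obtain ⟨d, hd1, hd2⟩ := exists_endpoints (n := n) (a := a) (b := b) (by omega) hb
        (fun h2 => h1.2.1 h2.1 h2.2)
      by_cases hd : d ∈ T₀
      · exact h1.2.2 d hd hd1 hd2
      · exact h d hd hd1 hd2

/-- The total height of a weight. -/
noncomputable def energy (w : PolygonDiagonal n → ℝ) : ℝ := ∑ d, w d * height n d.lo d.hi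

theorem height_pos (d : PolygonDiagonal n) : 1 ≤ height n d.lo d.hi := by
  obtain ⟨h1, h2, h3⟩ := lo_hi d
  have h1' : ((d.lo : ℕ) : ℝ) + 1 ≤ (d.hi : ℕ) := by exact_mod_cast h1.le
  have h2' : ((d.hi : ℕ) : ℝ) ≤ n + 2 := by exact_mod_cast h2
  have h4 : (0 : ℝ) ≤ (d.lo : ℕ) := Nat.cast_nonneg _
  unfold height
  nlinarith

theorem energy_add (w w' : PolygonDiagonal n → ℝ) : energy (w + w') = energy w + energy w' := by
  simp [energy, add_mul, Finset.sum_add_distrib]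

theorem energy_sub (w w' : PolygonDiagonal n → ℝ) : energy (w - w') = energy w - energy w' := by
  simp [energy, sub_mul, Finset.sum_sub_distrib]

theorem energy_smul (c : ℝ) (w : PolygonDiagonal n → ℝ) : energy (c • w) = c * energy w := by
  simp [energy, Finset.mul_sum, mul_assoc]

theorem energy_single (d : PolygonDiagonal n) :
    energy (Pi.single d 1) = height n d.lo d.hi := by
  rw [energy, Finset.sum_eq_single d]
  · simp
  · intro e _ he
    simp [he]
  · simp

theorem energy_chord_le (T₀ : Finset (PolygonDiagonal n)) {a b : ℕ} (hab : a < b)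
    (hb : b ≤ n + 2) : energy (chord T₀ a b) ≤ height n a b := by
  by_cases h : ∃ d : PolygonDiagonal n, d ∉ T₀ ∧ (d.lo : ℕ) = a ∧ (d.hi : ℕ) = b
  · obtain ⟨d, hd, rfl, rfl⟩ := h
    rw [chord_eq_single hd, energy_single]
  · push Not at h
    rw [chord_eq_zero fun d hd h' => h d hd h'.1 h'.2]
    have h1 : (a : ℝ) < b := by exact_mod_cast hab
    have h2 : (b : ℝ) ≤ n + 2 := by exact_mod_cast hb
    have h4 : (0 : ℝ) ≤ a := Nat.cast_nonneg _
    simp only [energy, Pi.zero_apply, zero_mul, Finset.sum_const_zero]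
    unfold height
    exact mul_nonneg (by linarith) (by linarith)

/-! ### Exchange relations in a quadrilateral -/

/-- The chord `xy` joins the arcs `[i,j]` and `[k,l]` properly. -/
def JoinA (i j k l x y : ℕ) : Prop :=
  i ≤ x ∧ x ≤ j ∧ k ≤ y ∧ y ≤ l ∧ ¬ ((x = i ∨ x = j) ∧ (y = k ∨ y = l))

/-- The chord `xy` joins the arcs `[j,k]` and `[l,i]` properly. -/
def JoinB (i j k l x y : ℕ) : Prop :=
  (j ≤ x ∧ x ≤ k ∧ l ≤ y ∧ ¬ ((x = j ∨ x = k) ∧ y = l)) ∨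
    (x ≤ i ∧ j ≤ y ∧ y ≤ k ∧ ¬ (x = i ∧ (y = j ∨ y = k)))

section crossing

variable {i j k l x y : ℕ}

/-- Apart from `ik` and `jl` themselves, only chords passing between the arcs `[j,k]` and `[l,i]`
can distinguish the two diagonals from the opposite sides `ij`, `kl`. -/
theorem sepInd_add_of_not_joinB (hij : i < j) (hjk : j < k) (hkl : k < l) (hxy : x < y)
    (hik : ¬ (x = i ∧ y = k)) (hjl : ¬ (x = j ∧ y = l)) (h : ¬ JoinB i j k l x y) :
    sepInd i j x y + sepInd k l x y = sepInd i k x y + sepInd j l x y := by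
  unfold sepInd
  simp only [sep_iff_of_lt hij, sep_iff_of_lt hkl, sep_iff_of_lt (hij.trans hjk),
    sep_iff_of_lt (hjk.trans hkl)]
  unfold JoinB at h
  split_ifs <;> first | (exfalso; omega) | norm_num

theorem sepInd_add_of_not_joinA (hij : i < j) (hjk : j < k) (hkl : k < l) (hxy : x < y)
    (hik : ¬ (x = i ∧ y = k)) (hjl : ¬ (x = j ∧ y = l)) (h : ¬ JoinA i j k l x y) :
    sepInd i l x y + sepInd j k x y = sepInd i k x y + sepInd j l x y := by
  unfold sepInd
  simp only [sep_iff_of_lt hjk, sep_iff_of_lt ((hij.trans hjk).trans hkl),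
    sep_iff_of_lt (hij.trans hjk), sep_iff_of_lt (hjk.trans hkl)]
  unfold JoinA at h
  split_ifs <;> first | (exfalso; omega) | norm_num

end crossing

section crossing

variable {i j k l x y : ℕ}

/-- Two non-crossing chords that join the two pairs of opposite arcs share a corner. -/
theorem exists_common_corner {x' y' : ℕ} (hij : i < j) (hjk : j < k) (hkl : k < l) (hxy : x < y)
    (hxy' : x' < y') (h : JoinA i j k l x y) (h' : JoinB i j k l x' y') (hs : ¬ Sep x y x' y') :
    ((x = i ∧ k < y ∧ y < l) ∧ (x' = i ∧ j < y' ∧ y' < k)) ∨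
    ((x = j ∧ k < y ∧ y < l) ∧ ((x' = j ∧ l < y') ∨ (x' < i ∧ y' = j))) ∨
    (((i < x ∧ x < j) ∧ y = k) ∧ ((x' = k ∧ l < y') ∨ (x' < i ∧ y' = k))) ∨
    (((i < x ∧ x < j) ∧ y = l) ∧ ((j < x' ∧ x' < k) ∧ y' = l)) := by
  rw [sep_iff_of_lt hxy] at hs
  obtain ⟨h1, h2, h3, h4, h5⟩ := h
  have hx : (i < x ∧ x < j) ∨ x = i ∨ x = j := by omega
  have hy : (k < y ∧ y < l) ∨ y = k ∨ y = l := by omega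
  unfold JoinB at h'
  rcases hx with hx | rfl | rfl
  · rcases hy with hy | rfl | rfl
    · exfalso; omega
    · exact Or.inr (Or.inr (Or.inl ⟨⟨hx, rfl⟩, by omega⟩))
    · exact Or.inr (Or.inr (Or.inr ⟨⟨hx, rfl⟩, by omega⟩))
  · rcases hy with hy | rfl | rfl
    · exact Or.inl ⟨⟨rfl, hy⟩, by omega⟩
    · exact absurd ⟨Or.inl rfl, Or.inl rfl⟩ h5
    · exact absurd ⟨Or.inl rfl, Or.inr rfl⟩ h5
  · rcases hy with hy | rfl | rfl
    · exact Or.inr (Or.inl ⟨⟨rfl, hy⟩, by omega⟩)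
    · exact absurd ⟨Or.inr rfl, Or.inl rfl⟩ h5
    · exact absurd ⟨Or.inr rfl, Or.inr rfl⟩ h5

/-- Two chords from `i`, one through `kl` and one through `jk`, obstruct both exchanges for opposite
sides. They also restrict the chords not crossing them enough for this weighted relation to hold.
The next three lemmas are its analogues at `j`, `k` and `l`. -/
theorem sepInd_corner_first {y₁ y₂ : ℕ} (hij : i < j) (hjk : j < k) (hkl : k < l) (hxy : x < y)
    (hik : ¬ (x = i ∧ y = k)) (hjl : ¬ (x = j ∧ y = l))
    (h₁ : k < y₁ ∧ y₁ < l)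
    (h₂ : j < y₂ ∧ y₂ < k) (hs₁ : ¬ Sep i y₁ x y) (hs₂ : ¬ Sep i y₂ x y) :
    sepInd j k x y + sepInd k l x y = 2 * sepInd i k x y + sepInd j l x y := by
  rw [sep_iff_of_lt (by omega)] at hs₁ hs₂
  unfold sepInd
  simp only [sep_iff_of_lt hjk, sep_iff_of_lt hkl,
    sep_iff_of_lt (hij.trans hjk), sep_iff_of_lt (hjk.trans hkl)]
  split_ifs <;> first | (exfalso; omega) | norm_num

theorem sepInd_corner_second {y₁ x₂ y₂ : ℕ} (hij : i < j) (hjk : j < k) (hkl : k < l)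
    (hxy : x < y) (hjl : ¬ (x = j ∧ y = l)) (h₁ : k < y₁ ∧ y₁ < l)
    (h₂ : (x₂ = j ∧ l < y₂) ∨ (x₂ < i ∧ y₂ = j))
    (hs₁ : ¬ Sep j y₁ x y) (hs₂ : ¬ Sep x₂ y₂ x y) :
    sepInd i l x y + sepInd k l x y = sepInd i k x y + 2 * sepInd j l x y := by
  rw [sep_iff_of_lt (by omega)] at hs₁ hs₂
  unfold sepInd
  simp only [sep_iff_of_lt hkl, sep_iff_of_lt ((hij.trans hjk).trans hkl),
    sep_iff_of_lt (hij.trans hjk), sep_iff_of_lt (hjk.trans hkl)]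
  split_ifs <;> first | (exfalso; omega) | norm_num

theorem sepInd_corner_third {x₁ x₂ y₂ : ℕ} (hij : i < j) (hjk : j < k) (hkl : k < l)
    (hxy : x < y) (hik : ¬ (x = i ∧ y = k)) (hjl : ¬ (x = j ∧ y = l))
    (h₁ : i < x₁ ∧ x₁ < j)
    (h₂ : (x₂ = k ∧ l < y₂) ∨ (x₂ < i ∧ y₂ = k))
    (hs₁ : ¬ Sep x₁ k x y) (hs₂ : ¬ Sep x₂ y₂ x y) :
    sepInd i j x y + sepInd i l x y = 2 * sepInd i k x y + sepInd j l x y := by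
  rw [sep_iff_of_lt (by omega)] at hs₁ hs₂
  unfold sepInd
  simp only [sep_iff_of_lt hij, sep_iff_of_lt ((hij.trans hjk).trans hkl),
    sep_iff_of_lt (hij.trans hjk), sep_iff_of_lt (hjk.trans hkl)]
  split_ifs <;> first | (exfalso; omega) | norm_num

theorem sepInd_corner_fourth {x₁ x₂ : ℕ} (hij : i < j) (hjk : j < k) (hkl : k < l)
    (hxy : x < y) (hjl : ¬ (x = j ∧ y = l)) (h₁ : i < x₁ ∧ x₁ < j) (h₂ : j < x₂ ∧ x₂ < k)
    (hs₁ : ¬ Sep x₁ l x y) (hs₂ : ¬ Sep x₂ l x y) :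
    sepInd i j x y + sepInd j k x y = sepInd i k x y + 2 * sepInd j l x y := by
  rw [sep_iff_of_lt (by omega)] at hs₁ hs₂
  unfold sepInd
  simp only [sep_iff_of_lt hij, sep_iff_of_lt hjk,
    sep_iff_of_lt (hij.trans hjk), sep_iff_of_lt (hjk.trans hkl)]
  split_ifs <;> first | (exfalso; omega) | norm_num

/-- A height is the product of the two arc lengths into which the chord cuts the cycle of length `n
+ 3`. In terms of the four arcs between `i`, `j`, `k`, `l`, each difference is a positive
combination of products of two arc lengths. -/
theorem height_lt (hij : i < j) (hjk : j < k) (hkl : k < l) (hl : l ≤ n + 2) :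
    height n i j + height n k l < height n i k + height n j l ∧
    height n i l + height n j k < height n i k + height n j l ∧
    height n j k + height n k l < 2 * height n i k + height n j l ∧
    height n i l + height n k l < height n i k + 2 * height n j l ∧
    height n i j + height n i l < 2 * height n i k + height n j l ∧
    height n i j + height n j k < height n i k + 2 * height n j l := by
  have ha : (0 : ℝ) < (j : ℝ) - i := by rw [sub_pos]; exact_mod_cast hij
  have hb : (0 : ℝ) < (k : ℝ) - j := by rw [sub_pos]; exact_mod_cast hjk
  have hc : (0 : ℝ) < (l : ℝ) - k := by rw [sub_pos]; exact_mod_cast hkl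
  have he : (0 : ℝ) < (n : ℝ) + 3 - (l - i) := by
    have h1 : (l : ℝ) ≤ n + 2 := by exact_mod_cast hl
    have h2 : (0 : ℝ) ≤ i := Nat.cast_nonneg i
    linarith
  have hab := mul_pos ha hb
  have hac := mul_pos ha hc
  have hae := mul_pos ha he
  have hbc := mul_pos hb hc
  have hbe := mul_pos hb he
  have hce := mul_pos hc he
  unfold height
  refine ⟨?_, ?_, ?_, ?_, ?_, ?_⟩ <;> nlinarith only [hab, hac, hae, hbc, hbe, hce]

end crossing

/-! ### Existence of laminations by energy minimisation -/

section resolution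

variable {T₀ : Finset (PolygonDiagonal n)}

/-- A weight `u` outside `T₀` that crosses `T₀` as `c₁ d + c₂ e` does and has smaller energy. -/
def Resolves (T₀ : Finset (PolygonDiagonal n)) (d e : PolygonDiagonal n) (c₁ c₂ : ℝ)
    (u : PolygonDiagonal n → ℝ) : Prop :=
  (∀ f, 0 ≤ u f) ∧ (∀ f ∈ T₀, u f = 0) ∧
    (∀ δ ∈ T₀, crossNum u δ.lo δ.hi =
      c₁ * sepInd d.lo d.hi δ.lo δ.hi + c₂ * sepInd e.lo e.hi δ.lo δ.hi) ∧
    energy u < c₁ * height n d.lo d.hi + c₂ * height n e.lo e.hi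

theorem resolves_chords (hT₀ : NonCrossing T₀) {d e : PolygonDiagonal n} {c c₁ c₂ : ℝ}
    (hc : 0 ≤ c) {a₁ b₁ a₂ b₂ : ℕ} (h₁ : a₁ < b₁) (h₁' : b₁ ≤ n + 2) (h₂ : a₂ < b₂)
    (h₂' : b₂ ≤ n + 2)
    (hs : ∀ δ ∈ T₀, c * (sepInd a₁ b₁ δ.lo δ.hi + sepInd a₂ b₂ δ.lo δ.hi) =
      c₁ * sepInd d.lo d.hi δ.lo δ.hi + c₂ * sepInd e.lo e.hi δ.lo δ.hi)
    (hh : c * (height n a₁ b₁ + height n a₂ b₂) <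
      c₁ * height n d.lo d.hi + c₂ * height n e.lo e.hi) :
    Resolves T₀ d e c₁ c₂ (c • (chord T₀ a₁ b₁ + chord T₀ a₂ b₂)) := by
  refine ⟨fun f => ?_, fun f hf => ?_, fun δ hδ => ?_, ?_⟩
  · exact mul_nonneg hc (add_nonneg (chord_nonneg _ _ _ _) (chord_nonneg _ _ _ _))
  · simp [chord_eq_zero_of_mem _ _ hf]
  · rw [← hs δ hδ, ← crossNum_chord hT₀ h₁ h₁' hδ, ← crossNum_chord hT₀ h₂ h₂' hδ]
    simp only [crossNum, weight_smul, weight_add]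
  · refine lt_of_le_of_lt ?_ hh
    rw [energy_smul, energy_add]
    exact mul_le_mul_of_nonneg_left
      (add_le_add (energy_chord_le T₀ h₁ h₁') (energy_chord_le T₀ h₂ h₂')) hc

/-- If `T₀` lacks chords of one of the kinds `JoinA`, `JoinB`, the pair is exchanged for two
opposite sides. Otherwise two chords of the two kinds share a corner, and half of each side away
from it replaces the diagonal at that corner plus half of the other. The bounds `c₁, c₂ ≤ 1` ensure
that an exchange of size `ε` uses at most `ε` of each diagonal. -/
theorem exists_resolves (hT₀ : NonCrossing T₀) {d e : PolygonDiagonal n} (hd : d ∉ T₀)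
    (he : e ∉ T₀) (h : d.lo < e.lo ∧ e.lo < d.hi ∧ d.hi < e.hi) :
    ∃ c₁ c₂ u, 0 ≤ c₁ ∧ c₁ ≤ 1 ∧ 0 ≤ c₂ ∧ c₂ ≤ 1 ∧ Resolves T₀ d e c₁ c₂ u := by
  obtain ⟨hij, hjk, hkl⟩ := h
  rw [Fin.lt_def] at hij hjk hkl
  have hl := (lo_hi e).2.1
  obtain ⟨g1, g2, g3, g4, g5, g6⟩ := height_lt hij hjk hkl hl
  have hlt : ∀ δ : PolygonDiagonal n, (δ.lo : ℕ) < δ.hi := fun δ => by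
    have := lo_hi δ; omega
  have hd' : ∀ δ ∈ T₀, ¬ ((δ.lo : ℕ) = d.lo ∧ (δ.hi : ℕ) = d.hi) := fun δ hδ h =>
    hd (ext_endpoints h.1 h.2 ▸ hδ)
  have he' : ∀ δ ∈ T₀, ¬ ((δ.lo : ℕ) = e.lo ∧ (δ.hi : ℕ) = e.hi) := fun δ hδ h =>
    he (ext_endpoints h.1 h.2 ▸ hδ)
  by_cases hB : ∀ δ ∈ T₀, ¬ JoinB d.lo e.lo d.hi e.hi δ.lo δ.hi
  · refine ⟨1, 1, _, by norm_num, by norm_num, by norm_num, by norm_num,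
      resolves_chords hT₀ zero_le_one hij (by omega) hkl hl (fun δ hδ => ?_) (by linarith)⟩
    rw [sepInd_add_of_not_joinB hij hjk hkl (hlt δ) (hd' δ hδ) (he' δ hδ) (hB δ hδ)]
    ring
  by_cases hA : ∀ δ ∈ T₀, ¬ JoinA d.lo e.lo d.hi e.hi δ.lo δ.hi
  · refine ⟨1, 1, _, by norm_num, by norm_num, by norm_num, by norm_num,
      resolves_chords hT₀ zero_le_one ((hij.trans hjk).trans hkl) hl hjk (by omega)
        (fun δ hδ => ?_) (by linarith)⟩
    rw [sepInd_add_of_not_joinA hij hjk hkl (hlt δ) (hd' δ hδ) (he' δ hδ) (hA δ hδ)]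
    ring
  push Not at hA hB
  obtain ⟨α, hα, hαA⟩ := hA
  obtain ⟨β, hβ, hβB⟩ := hB
  have hns : ∀ {a b : PolygonDiagonal n}, a ∈ T₀ → b ∈ T₀ → ¬ Sep a.lo a.hi b.lo b.hi := by
    intro a b ha hb
    rw [← crosses_iff_sep]
    exact hT₀ a ha b hb
  have hα' := fun δ (hδ : δ ∈ T₀) => hns hα hδ
  have hβ' := fun δ (hδ : δ ∈ T₀) => hns hβ hδ
  rcases exists_common_corner hij hjk hkl (hlt α) (hlt β) hαA hβB (hns hα hβ) with
    ⟨⟨hx, h1⟩, hx', h2⟩ | ⟨⟨hx, h1⟩, h2⟩ | ⟨⟨h1, hx⟩, h2⟩ | ⟨⟨h1, hx⟩, h2, hx'⟩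
  · rw [hx] at hα'
    rw [hx'] at hβ'
    refine ⟨1, 1 / 2, _, by norm_num, by norm_num, by norm_num, by norm_num,
      resolves_chords hT₀ (c := 1 / 2) (by norm_num) hjk (by omega) hkl hl
        (fun δ hδ => ?_) (by linarith)⟩
    have := sepInd_corner_first hij hjk hkl (hlt δ) (hd' δ hδ) (he' δ hδ) h1 h2
      (hα' δ hδ) (hβ' δ hδ)
    linarith
  · rw [hx] at hα'
    refine ⟨1 / 2, 1, _, by norm_num, by norm_num, by norm_num, by norm_num,
      resolves_chords hT₀ (c := 1 / 2) (by norm_num) ((hij.trans hjk).trans hkl) hl hkl hl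
        (fun δ hδ => ?_) (by linarith)⟩
    have := sepInd_corner_second hij hjk hkl (hlt δ) (he' δ hδ) h1 h2
      (hα' δ hδ) (hβ' δ hδ)
    linarith
  · rw [hx] at hα'
    refine ⟨1, 1 / 2, _, by norm_num, by norm_num, by norm_num, by norm_num,
      resolves_chords hT₀ (c := 1 / 2) (by norm_num) hij (by omega) ((hij.trans hjk).trans hkl) hl
        (fun δ hδ => ?_) (by linarith)⟩
    have := sepInd_corner_third hij hjk hkl (hlt δ) (hd' δ hδ) (he' δ hδ) h1 h2
      (hα' δ hδ) (hβ' δ hδ)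
    linarith
  · rw [hx] at hα'
    rw [hx'] at hβ'
    refine ⟨1 / 2, 1, _, by norm_num, by norm_num, by norm_num, by norm_num,
      resolves_chords hT₀ (c := 1 / 2) (by norm_num) hij (by omega) hjk (by omega)
        (fun δ hδ => ?_) (by linarith)⟩
    have := sepInd_corner_fourth hij hjk hkl (hlt δ) (he' δ hδ) h1 h2
      (hα' δ hδ) (hβ' δ hδ)
    linarith

/-- Each member of a triangulation is crossed, alone, by some diagonal. -/
theorem IsTriangulation.exists_flip (hT₀ : IsTriangulation T₀) {δ : PolygonDiagonal n}
    (hδ : δ ∈ T₀) : ∃ e : PolygonDiagonal n,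
      ∀ δ' ∈ T₀, (Sep e.lo e.hi δ'.lo δ'.hi ↔ δ' = δ) := by
  have hδl := lo_hi δ
  have hE := edge_of_mem hδ
  -- The triangles on both sides of `δ` form a quadrilateral, and `e` is its other diagonal. A
  -- member of `T₀` crossing `e` without crossing the four sides is `δ`.
  obtain ⟨z, hz1, hz2⟩ := hT₀.exists_inner_apex hE (by omega)
  obtain ⟨v, hv⟩ := hT₀.exists_outer_apex hE hδl.2.2
  have hzl := hz1.1
  have hzl2 := hz2.1
  rcases hv with ⟨hv1, hv2⟩ | ⟨hv1, hv2⟩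
  · have hvl := hv1.1
    obtain ⟨e, he1, he2⟩ := exists_endpoints (n := n) (a := v) (b := z)
      (by omega) (by omega) (by omega)
    refine ⟨e, fun δ' hδ' => ?_⟩
    have hE' := edge_of_mem hδ'
    have n0 := hE'.1
    rw [he1, he2, sep_iff_of_lt (by omega)]
    refine ⟨fun hs => ?_, by rintro rfl; omega⟩
    have n1 := hT₀.prop.edge_not_sep hz1 hE'
    have n2 := hT₀.prop.edge_not_sep hz2 hE'
    have n4 := hT₀.prop.edge_not_sep hv1 hE'
    have n5 := hT₀.prop.edge_not_sep hv2 hE'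
    rw [sep_iff_of_lt (by omega)] at n1 n2 n4 n5
    clear hE' hE hz1 hz2 hv1 hv2
    have : (δ'.lo : ℕ) = δ.lo ∧ (δ'.hi : ℕ) = δ.hi := by
      rcases hs with hs | hs
      · constructor <;> omega
      · exfalso; omega
    exact ext_endpoints this.1 this.2
  · have hvl := hv2.1
    have hvn := hv2.2.1
    obtain ⟨e, he1, he2⟩ := exists_endpoints (n := n) (a := z) (b := v)
      (by omega) (by omega) (by omega)
    refine ⟨e, fun δ' hδ' => ?_⟩
    have hE' := edge_of_mem hδ'
    have n0 := hE'.1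
    rw [he1, he2, sep_iff_of_lt (by omega)]
    refine ⟨fun hs => ?_, by rintro rfl; omega⟩
    have n1 := hT₀.prop.edge_not_sep hz1 hE'
    have n2 := hT₀.prop.edge_not_sep hz2 hE'
    have n4 := hT₀.prop.edge_not_sep hv1 hE'
    have n5 := hT₀.prop.edge_not_sep hv2 hE'
    rw [sep_iff_of_lt (by omega)] at n1 n2 n4 n5
    clear hE' hE hz1 hz2 hv1 hv2
    have : (δ'.lo : ℕ) = δ.lo ∧ (δ'.hi : ℕ) = δ.hi := by
      rcases hs with hs | hs
      · exfalso; omega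
      · constructor <;> omega
    exact ext_endpoints this.1 this.2

/-- Weight `x δ` is placed on the flip of `δ`, which crosses `δ` and nothing else in `T₀`. -/
theorem IsTriangulation.exists_crossNum_eq (hT₀ : IsTriangulation T₀)
    (x : PolygonDiagonal n → ℝ) (hx : ∀ δ ∈ T₀, 0 ≤ x δ) :
    ∃ w : PolygonDiagonal n → ℝ, (∀ d, 0 ≤ w d) ∧ (∀ d ∈ T₀, w d = 0) ∧
      ∀ δ ∈ T₀, crossNum w δ.lo δ.hi = x δ := by
  classical
  have hex : ∀ δ : PolygonDiagonal n, ∃ e : PolygonDiagonal n, δ ∈ T₀ →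
      ∀ δ' ∈ T₀, (Sep e.lo e.hi δ'.lo δ'.hi ↔ δ' = δ) := fun δ => by
    by_cases hδ : δ ∈ T₀
    · obtain ⟨e, he⟩ := IsTriangulation.exists_flip hT₀ hδ
      exact ⟨e, fun _ => he⟩
    · exact ⟨δ, fun h => absurd h hδ⟩
  choose f hf using hex
  have hfT : ∀ δ ∈ T₀, f δ ∉ T₀ := fun δ hδ hfδ =>
    hT₀.prop (f δ) hfδ δ hδ ((crosses_iff_sep _ _).2 ((hf δ hδ δ hδ).2 rfl))
  refine ⟨fun e => ∑ δ ∈ T₀, if f δ = e then x δ else 0, fun e => ?_, fun e he => ?_,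
    fun δ₀ hδ₀ => ?_⟩
  · exact Finset.sum_nonneg fun δ hδ => by split_ifs <;> simp [hx δ hδ]
  · refine Finset.sum_eq_zero fun δ hδ => if_neg ?_
    rintro rfl
    exact hfT δ hδ he
  · calc crossNum (fun e => ∑ δ ∈ T₀, if f δ = e then x δ else 0) δ₀.lo δ₀.hi
        = ∑ δ ∈ T₀, ∑ e, if f δ = e then
            (if Sep e.lo e.hi δ₀.lo δ₀.hi then x δ else 0) else 0 := by
          rw [Finset.sum_comm, crossNum, weight]
          refine Finset.sum_congr rfl fun e _ => ?_
          split_ifs with h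
          · rfl
          · simp
      _ = ∑ δ ∈ T₀, if δ = δ₀ then x δ else 0 := by
          refine Finset.sum_congr rfl fun δ hδ => ?_
          rw [Finset.sum_ite_eq]
          simp only [Finset.mem_univ, if_true]
          exact if_congr ((hf δ hδ δ₀ hδ₀).trans eq_comm) rfl rfl
      _ = x δ₀ := by simp [hδ₀]

theorem continuous_weight (P : PolygonDiagonal n → Prop) [DecidablePred P] :
    Continuous fun w : PolygonDiagonal n → ℝ => weight w P := by
  unfold weight
  refine continuous_finsetSum _ fun d _ => ?_
  split_ifs
  · exact continuous_apply d
  · exact continuous_const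

theorem IsTriangulation.exists_isLamination (hT₀ : IsTriangulation T₀)
    (x : PolygonDiagonal n → ℝ) (hx : ∀ δ ∈ T₀, 0 ≤ x δ) :
    ∃ w, IsLamination T₀ w ∧ ∀ δ ∈ T₀, crossNum w δ.lo δ.hi = x δ := by
  obtain ⟨w₀, h0, h0', h0''⟩ := hT₀.exists_crossNum_eq x hx
  -- The energy bound makes `K` compact: heights of diagonals are at least `1`, so each weight is at
  -- most the energy.
  set K : Set (PolygonDiagonal n → ℝ) := {w | (∀ d, 0 ≤ w d) ∧ (∀ d ∈ T₀, w d = 0) ∧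
      (∀ δ ∈ T₀, crossNum w δ.lo δ.hi = x δ) ∧ energy w ≤ energy w₀} with hK
  have hcE : Continuous (energy : (PolygonDiagonal n → ℝ) → ℝ) := by
    unfold energy
    fun_prop
  have hclosed : IsClosed K := by
    simp only [hK, Set.ofPred_and, Set.ofPred_forall]
    refine IsClosed.inter (isClosed_iInter fun d => ?_) (IsClosed.inter
      (isClosed_iInter fun d => isClosed_iInter fun _ => ?_) (IsClosed.inter
      (isClosed_iInter fun d => isClosed_iInter fun _ => ?_) ?_))
    · exact isClosed_le continuous_const (continuous_apply d)
    · exact isClosed_eq (continuous_apply d) continuous_const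
    · exact isClosed_eq (continuous_weight _) continuous_const
    · exact isClosed_le hcE continuous_const
  have hcompact : IsCompact K := by
    refine (isCompact_univ_pi fun _ : PolygonDiagonal n =>
      isCompact_Icc (a := (0 : ℝ)) (b := energy w₀)).of_isClosed_subset hclosed ?_
    rintro w ⟨h1, _, _, h4⟩ d _
    refine ⟨h1 d, le_trans ?_ h4⟩
    have h5 : ∀ e ∈ Finset.univ, 0 ≤ w e * height n e.lo e.hi := fun e _ =>
      mul_nonneg (h1 e) (zero_le_one.trans (height_pos e))
    exact (le_mul_of_one_le_right (h1 d) (height_pos d)).trans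
      (Finset.single_le_sum h5 (Finset.mem_univ d))
  obtain ⟨w, ⟨h1, h2, h3, h4⟩, hmin⟩ := hcompact.exists_isMinOn
    ⟨w₀, h0, h0', h0'', le_rfl⟩ hcE.continuousOn
  refine ⟨w, ⟨h1, ?_, h2⟩, h3⟩
  have key : ∀ d e, 0 < w d → 0 < w e → ¬ (d.lo < e.lo ∧ e.lo < d.hi ∧ d.hi < e.hi) := by
    intro d e hd he hde
    have hdT : d ∉ T₀ := fun h => hd.ne' (h2 d h)
    have heT : e ∉ T₀ := fun h => he.ne' (h2 e h)
    obtain ⟨c₁, c₂, u, hc1, hc1', hc2, hc2', hu1, hu2, hu3, hu4⟩ :=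
      exists_resolves hT₀.prop hdT heT hde
    have hne : d ≠ e := by
      rintro rfl
      exact lt_irrefl _ hde.1
    set ε := min (w d) (w e) with hε
    have hεpos : 0 < ε := lt_min hd he
    -- An amount `ε` of the crossing pair is exchanged for `ε • u`; taking the smaller of the two
    -- weights as `ε` keeps everything nonnegative.
    set w' := w + ε • (u - (c₁ • Pi.single d 1 + c₂ • Pi.single e 1)) with hw'
    have hlt : energy w' < energy w := by
      have : energy (u - (c₁ • Pi.single d 1 + c₂ • Pi.single e 1)) < 0 := by
        rw [energy_sub, energy_add, energy_smul, energy_smul, energy_single, energy_single]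
        linarith
      rw [hw', energy_add, energy_smul]
      linarith [mul_neg_of_pos_of_neg hεpos this]
    have hmem : w' ∈ K := by
      refine ⟨fun f => ?_, fun f hf => ?_, fun δ hδ => ?_, hlt.le.trans h4⟩
      · have hu := mul_nonneg hεpos.le (hu1 f)
        have hεd : ε ≤ w d := min_le_left _ _
        have hεe : ε ≤ w e := min_le_right _ _
        have m1 := mul_le_mul_of_nonneg_left hc1' hεpos.le
        have m2 := mul_le_mul_of_nonneg_left hc2' hεpos.le
        have hwf := h1 f
        simp only [hw', Pi.add_apply, Pi.smul_apply, Pi.sub_apply, smul_eq_mul, mul_sub, mul_add]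
        by_cases hfd : f = d
        · subst hfd
          rw [Pi.single_eq_same, Pi.single_eq_of_ne hne]
          linarith
        · rw [Pi.single_eq_of_ne hfd]
          by_cases hfe : f = e
          · subst hfe
            rw [Pi.single_eq_same]
            linarith
          · rw [Pi.single_eq_of_ne hfe]
            linarith
      · have hfd : f ≠ d := fun h => hdT (h ▸ hf)
        have hfe : f ≠ e := fun h => heT (h ▸ hf)
        simp [hw', h2 f hf, hu2 f hf, Pi.single_eq_of_ne hfd, Pi.single_eq_of_ne hfe]
      · have := hu3 δ hδ
        rw [← h3 δ hδ]
        simp only [crossNum, sepInd, hw', weight_add, weight_smul, weight_sub,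
          weight_single] at this ⊢
        rw [this]
        ring
    exact absurd (hmin hmem) (not_le.2 hlt)
  rintro d e hd he (hde | hde)
  · exact key d e hd he hde
  · exact key e d he hd hde

end resolution

/-! ### Compatible expansions of vectors -/

variable {T₀ : Finset (PolygonDiagonal n)}

/-- The weight `c` with its values on `T₀` replaced by zero. -/
noncomputable def offSeed (T₀ : Finset (PolygonDiagonal n)) (c : PolygonDiagonal n → ℝ) :
    PolygonDiagonal n → ℝ :=
  fun d => if d ∈ T₀ then 0 else c d

/-- The weight `c` is nonnegative and supported on pairwise non-crossing diagonals. -/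
structure IsCompatible (c : PolygonDiagonal n → ℝ) : Prop where
  nonneg : ∀ d, 0 ≤ c d
  not_crosses : ∀ d e, 0 < c d → 0 < c e → ¬ Crosses d e

theorem IsCompatible.of_noncrossing {T : Finset (PolygonDiagonal n)} (hT : NonCrossing T)
    {c : PolygonDiagonal n → ℝ} (h0 : ∀ d, 0 ≤ c d) (hc : ∀ d ∉ T, c d = 0) :
    IsCompatible c := by
  have h : ∀ d, 0 < c d → d ∈ T := fun d hd => by
    by_contra hdT
    exact hd.ne' (hc d hdT)
  exact ⟨h0, fun d e hd he => hT d (h d hd) e (h e he)⟩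

theorem IsCompatible.isLamination_offSeed {c : PolygonDiagonal n → ℝ} (hc : IsCompatible c) :
    IsLamination T₀ (offSeed T₀ c) := by
  have h : ∀ d, 0 < offSeed T₀ c d → 0 < c d := fun d hd => by
    unfold offSeed at hd
    split_ifs at hd
    · exact absurd hd (lt_irrefl _)
    · exact hd
  refine ⟨fun d => ?_, fun d e hd he => hc.not_crosses d e (h d hd) (h e he), fun d hd => ?_⟩
  · unfold offSeed
    split_ifs
    · exact le_rfl
    · exact hc.nonneg d
  · simp [offSeed, hd]

section linear

variable {V : Type*} [AddCommGroup V] [Module ℝ V] (α : Module.Basis T₀ ℝ V)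

/-- The linear combination of the vectors of all diagonals with coefficients `c`. -/
noncomputable def comb (c : PolygonDiagonal n → ℝ) : V := ∑ d, c d • vec α d

theorem repr_vec (d : PolygonDiagonal n) (δ : T₀) :
    α.repr (vec α d) δ = if d ∈ T₀ then (if d = δ then -1 else 0)
      else if Sep d.lo d.hi δ.1.lo δ.1.hi then 1 else 0 := by
  classical
  unfold vec
  split_ifs with h1 h2 h2
  · subst h2
    simp
  · have : (⟨d, h1⟩ : T₀) ≠ δ := fun h => h2 (congrArg Subtype.val h)
    simp [this]
  · simp only [map_sum, Module.Basis.repr_self, Finsupp.finsetSum_apply, Finsupp.single_apply,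
      Finset.sum_ite_eq', Finset.mem_filter, Finset.mem_univ, true_and]
    rw [if_pos ((crosses_iff_sep _ _).2 h2)]
  · simp only [map_sum, Module.Basis.repr_self, Finsupp.finsetSum_apply, Finsupp.single_apply,
      Finset.sum_ite_eq', Finset.mem_filter, Finset.mem_univ, true_and]
    rw [if_neg (mt (crosses_iff_sep _ _).1 h2)]

theorem repr_comb (c : PolygonDiagonal n → ℝ) (δ : T₀) :
    α.repr (comb α c) δ = crossNum (offSeed T₀ c) δ.1.lo δ.1.hi - c δ := by
  have h : c δ = ∑ d, if d = δ.1 then c d else 0 := by simp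
  rw [h, crossNum, weight, ← Finset.sum_sub_distrib, comb, map_sum, Finsupp.finsetSum_apply]
  refine Finset.sum_congr rfl fun d _ => ?_
  rw [map_smul, Finsupp.smul_apply, repr_vec, offSeed]
  by_cases h1 : d ∈ T₀
  · by_cases h2 : d = δ.1 <;> simp [h1, h2]
  · have h2 : d ≠ δ.1 := fun h => h1 (h ▸ δ.2)
    by_cases h3 : Sep d.lo d.hi δ.1.lo δ.1.hi <;> simp [h1, h2, h3]

/-- If `c δ > 0`, nothing in the support crosses `δ`, so the coordinate is `-c δ`; if `c δ = 0`, the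
coordinate is a crossing number, hence nonnegative. -/
theorem IsCompatible.coeff_eq {c : PolygonDiagonal n → ℝ} (hc : IsCompatible c) (δ : T₀) :
    c δ = max 0 (-α.repr (comb α c) δ) := by
  have hL : IsLamination T₀ (offSeed T₀ c) := hc.isLamination_offSeed
  have hnn : 0 ≤ crossNum (offSeed T₀ c) δ.1.lo δ.1.hi := weight_nonneg hL.nonneg
  rw [repr_comb]
  rcases (hc.nonneg δ).eq_or_lt with h | h
  · rw [← h, max_eq_left]
    linarith
  · have h0 : crossNum (offSeed T₀ c) δ.1.lo δ.1.hi = 0 := by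
      refine le_antisymm (not_lt.1 fun hlt => ?_) hnn
      obtain ⟨d, hd, hs⟩ := (weight_pos_iff hL.nonneg).1 hlt
      have hd' : 0 < c d := by
        unfold offSeed at hd
        split_ifs at hd
        · exact absurd hd (lt_irrefl _)
        · exact hd
      exact hc.not_crosses d δ hd' h ((crosses_iff_sep _ _).2 hs)
    rw [h0, zero_sub, neg_neg, max_eq_right h.le]

theorem IsCompatible.eq_of_comb_eq (hT₀ : IsTriangulation T₀) {c c' : PolygonDiagonal n → ℝ}
    (hc : IsCompatible c) (hc' : IsCompatible c') (h : comb α c = comb α c') : c = c' := by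
  have h1 : ∀ δ : T₀, c δ = c' δ := fun δ => by
    rw [hc.coeff_eq α δ, hc'.coeff_eq α δ, h]
  have h2 : offSeed T₀ c = offSeed T₀ c' := by
    refine hc.isLamination_offSeed.eq_of_crossNum_eq hT₀ hc'.isLamination_offSeed fun δ hδ => ?_
    have h3 := repr_comb α c ⟨δ, hδ⟩
    have h4 := repr_comb α c' ⟨δ, hδ⟩
    have h5 := h1 ⟨δ, hδ⟩
    rw [h] at h3
    simp only at h3 h4 h5
    linarith
  funext d
  by_cases hd : d ∈ T₀
  · exact h1 ⟨d, hd⟩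
  · have := congrFun h2 d
    simpa [offSeed, hd] using this

/-- The positive parts of the coordinates are realised by a lamination and the negative parts are
put on `T₀`. The two are compatible: where the coordinate at `δ` is negative, the lamination has
crossing number zero with `δ`. -/
theorem exists_isCompatible (hT₀ : IsTriangulation T₀) (x : V) :
    ∃ c, IsCompatible c ∧ comb α c = x := by
  classical
  set r : PolygonDiagonal n → ℝ := fun d => if h : d ∈ T₀ then α.repr x ⟨d, h⟩ else 0 with hr
  obtain ⟨w, hw, hwr⟩ := hT₀.exists_isLamination (fun d => max (r d) 0)
    fun δ _ => le_max_right _ _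
  have hr0 : ∀ d ∉ T₀, r d = 0 := fun d hd => by simp [hr, hd]
  have hmix : ∀ d e, 0 < w d → 0 < max (-r e) 0 → ¬ Crosses d e := by
    intro d e hd he hcr
    have he' : r e < 0 := by
      rcases lt_max_iff.1 he with h | h
      · linarith
      · exact absurd h (lt_irrefl _)
    have heT : e ∈ T₀ := by
      by_contra heT
      exact he'.ne (hr0 e heT)
    have h1 := hwr e heT
    have h2 : 0 < crossNum w e.lo e.hi :=
      (weight_pos_iff hw.nonneg).2 ⟨d, hd, (crosses_iff_sep _ _).1 hcr⟩
    rw [h1, max_eq_right he'.le] at h2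
    exact lt_irrefl _ h2
  have hmem : ∀ d, 0 < max (-r d) 0 → d ∈ T₀ := by
    intro d hd
    by_contra hdT
    simp [hr0 d hdT] at hd
  refine ⟨fun d => w d + max (-r d) 0,
    ⟨fun d => add_nonneg (hw.nonneg d) (le_max_right _ _), fun d e hd he => ?_⟩, ?_⟩
  · have hsplit : ∀ d, 0 < w d + max (-r d) 0 → 0 < w d ∨ 0 < max (-r d) 0 := by
      intro d hd
      by_contra h
      rw [not_or, not_lt, not_lt] at h
      linarith [h.1, h.2]
    rcases hsplit d hd with h1 | h1 <;> rcases hsplit e he with h2 | h2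
    · exact hw.not_crosses d e h1 h2
    · exact hmix d e h1 h2
    · rw [crosses_comm]; exact hmix e d h2 h1
    · exact hT₀.prop d (hmem d h1) e (hmem e h2)
  · refine α.repr.injective (Finsupp.ext fun δ => ?_)
    rw [repr_comb]
    have h1 : offSeed T₀ (fun d => w d + max (-r d) 0) = w := by
      funext d
      by_cases hd : d ∈ T₀
      · simp [offSeed, hd, hw.eq_zero_of_mem d hd]
      · simp [offSeed, hd, hr0 d hd]
    have h2 : r δ = α.repr x δ := by simp [hr]
    rw [h1, hwr δ δ.2, hw.eq_zero_of_mem δ δ.2, h2]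
    rcases le_total (α.repr x δ) 0 with h | h
    · rw [max_eq_right h, max_eq_left (by linarith)]; ring
    · rw [max_eq_left h, max_eq_right (by linarith)]; ring

theorem comb_add (c c' : PolygonDiagonal n → ℝ) : comb α (c + c') = comb α c + comb α c' := by
  simp [comb, add_smul, Finset.sum_add_distrib]

theorem comb_sub (c c' : PolygonDiagonal n → ℝ) : comb α (c - c') = comb α c - comb α c' := by
  simp [comb, sub_smul, Finset.sum_sub_distrib]

theorem comb_smul (a : ℝ) (c : PolygonDiagonal n → ℝ) : comb α (a • c) = a • comb α c := by
  simp [comb, Finset.smul_sum, mul_smul]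

theorem comb_single (d : PolygonDiagonal n) : comb α (Pi.single d 1) = vec α d := by
  rw [comb, Finset.sum_eq_single d]
  · simp
  · intro e _ he
    simp [he]
  · simp

theorem mem_cone_iff {S : Finset (PolygonDiagonal n)} {x : V} :
    x ∈ cone α S ↔ ∃ c : PolygonDiagonal n → ℝ, (∀ d, 0 ≤ c d) ∧ (∀ d ∉ S, c d = 0) ∧
      comb α c = x := by
  constructor
  · intro hx
    induction hx using Submodule.span_induction with
    | mem x hx =>
      obtain ⟨d, hd, rfl⟩ := hx
      refine ⟨Pi.single d 1, fun e => ?_, fun e he => ?_, comb_single α d⟩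
      · by_cases h : e = d
        · subst h; simp
        · simp [h]
      · have h : e ≠ d := by rintro rfl; exact he hd
        simp [h]
    | zero => exact ⟨0, fun _ => le_rfl, fun _ _ => rfl, by simp [comb]⟩
    | add x y _ _ hx hy =>
      obtain ⟨c, h1, h2, rfl⟩ := hx
      obtain ⟨c', h1', h2', rfl⟩ := hy
      exact ⟨c + c', fun d => add_nonneg (h1 d) (h1' d),
        fun d hd => by simp [h2 d hd, h2' d hd], comb_add α c c'⟩
    | smul a x _ hx =>
      obtain ⟨c, h1, h2, rfl⟩ := hx
      exact ⟨(a : ℝ) • c, fun d => mul_nonneg a.2 (h1 d),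
        fun d hd => by simp [h2 d hd], comb_smul α _ c⟩
  · rintro ⟨c, h1, h2, rfl⟩
    refine Submodule.sum_mem _ fun d _ => ?_
    by_cases hd : d ∈ S
    · exact PointedCone.smul_mem _ (h1 d) (PointedCone.subset_hull ⟨d, hd, rfl⟩)
    · rw [h2 d hd, zero_smul]
      exact Submodule.zero_mem _

/-! ### Cones, faces and the fan -/

variable {S T : Finset (PolygonDiagonal n)}

theorem vec_mem_cone {d : PolygonDiagonal n} (hd : d ∈ S) : vec α d ∈ cone α S :=
  PointedCone.subset_hull ⟨d, hd, rfl⟩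

/-- The positive and negative parts of a linear relation are two compatible expansions of one
vector, so they coincide and the relation is trivial. -/
theorem linearIndependent_vec (hT₀ : IsTriangulation T₀) (hT : NonCrossing T) :
    LinearIndependent ℝ (fun d : T => vec α d.1) := by
  classical
  rw [Fintype.linearIndependent_iff]
  intro g hg
  set G : PolygonDiagonal n → ℝ := fun d => if h : d ∈ T then g ⟨d, h⟩ else 0 with hG
  have hG0 : ∀ d ∉ T, G d = 0 := fun d hd => by simp [hG, hd]
  have hcomb : comb α G = 0 := by
    rw [← hg, comb, ← Finset.sum_subset (Finset.subset_univ T)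
      (fun d _ hd => by rw [hG0 d hd, zero_smul]), ← Finset.sum_coe_sort]
    exact Finset.sum_congr rfl fun d _ => by simp [hG]
  have hsub : (fun d => max (G d) 0) - (fun d => max (-G d) 0) = G := by
    funext d
    simp only [Pi.sub_apply]
    rcases le_total (G d) 0 with h | h
    · rw [max_eq_right h, max_eq_left (by linarith)]; ring
    · rw [max_eq_left h, max_eq_right (by linarith)]; ring
  have heq := IsCompatible.eq_of_comb_eq α hT₀
    (IsCompatible.of_noncrossing hT (c := fun d => max (G d) 0) (fun d => le_max_right _ _)
      fun d hd => by simp [hG0 d hd])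
    (IsCompatible.of_noncrossing hT (c := fun d => max (-G d) 0) (fun d => le_max_right _ _)
      fun d hd => by simp [hG0 d hd])
    (sub_eq_zero.1 (by rw [← comb_sub, hsub, hcomb]))
  intro d
  have h1 := congrFun hsub d
  rw [heq, sub_self] at h1
  have h2 : G d = g d := by simp [hG]
  rw [← h2, ← h1]
  rfl

/-- Independence is applied in the coordinate space on `T₀`. Since any triangulation may serve as
seed, exchanging the roles shows that all have equal size. -/
theorem IsTriangulation.card_le (hT₀ : IsTriangulation T₀) (hT : IsTriangulation T) :
    T.card ≤ T₀.card := by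
  have := (linearIndependent_vec (Pi.basisFun ℝ T₀) hT₀ hT.prop).fintype_card_le_finrank
  simpa using this

theorem span_vec (hT₀ : IsTriangulation T₀) (hT : IsTriangulation T) :
    Submodule.span ℝ (vec α '' (T : Set (PolygonDiagonal n))) = ⊤ := by
  have hfin : Module.Finite ℝ V := Module.Finite.of_basis α
  have hcard : Fintype.card T = Module.finrank ℝ V := by
    rw [Module.finrank_eq_card_basis α]
    simpa using le_antisymm (hT₀.card_le hT) (hT.card_le hT₀)
  have := (linearIndependent_vec α hT₀ hT.prop).span_eq_top_of_card_eq_finrank' hcard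
  rwa [Set.image_eq_range]

theorem cone_mono (h : S ⊆ T) : cone α S ≤ cone α T :=
  Submodule.span_mono (Set.image_mono (Finset.coe_subset.2 h))

theorem NonCrossing.mono (hT : NonCrossing T) (h : S ⊆ T) : NonCrossing S :=
  fun d hd e he => hT d (h hd) e (h he)

/-- By uniqueness, the coefficients of `x + y` are the sums of those of `x` and `y`; being
nonnegative with sum zero outside `S`, they both vanish there. -/
theorem cone_isFaceOf (hT₀ : IsTriangulation T₀) (hT : NonCrossing T) (h : S ⊆ T) :
    (cone α S).IsFaceOf (cone α T) := by
  refine PointedCone.IsFaceOf.of_mem_of_add_mem_left (cone_mono α h) fun {x y} hx hy hxy => ?_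
  obtain ⟨a, ha0, ha, rfl⟩ := (mem_cone_iff α).1 hx
  obtain ⟨b, hb0, hb, rfl⟩ := (mem_cone_iff α).1 hy
  obtain ⟨c, hc0, hc, hcomb⟩ := (mem_cone_iff α).1 hxy
  have heq : c = a + b := IsCompatible.eq_of_comb_eq α hT₀
    (IsCompatible.of_noncrossing (hT.mono h) hc0 hc)
    (IsCompatible.of_noncrossing hT (fun d => add_nonneg (ha0 d) (hb0 d))
      fun d hd => by simp [ha d hd, hb d hd]) (hcomb.trans (comb_add α a b).symm)
  refine (mem_cone_iff α).2 ⟨a, ha0, fun d hd => ?_, rfl⟩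
  have h1 := congrFun heq d
  rw [hc d hd, Pi.add_apply] at h1
  linarith [ha0 d, hb0 d]

/-- A face contains every term of a sum of cone elements that lies in it, so it is generated by the
vectors of `T` that it contains. -/
theorem exists_eq_cone_of_isFaceOf {F : PointedCone ℝ V} (hF : F.IsFaceOf (cone α T)) :
    ∃ S ⊆ T, F = cone α S := by
  classical
  refine ⟨T.filter fun d => vec α d ∈ F, Finset.filter_subset _ _, le_antisymm ?_ ?_⟩
  · intro x hx
    obtain ⟨c, hc0, hc, rfl⟩ := (mem_cone_iff α).1 (hF.le hx)
    refine (mem_cone_iff α).2 ⟨c, hc0, fun d hd => ?_, rfl⟩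
    by_contra hne
    have hdT : d ∈ T := by
      by_contra h
      exact hne (hc d h)
    refine hd (Finset.mem_filter.2 ⟨hdT, ?_⟩)
    have hterm : c d • vec α d ∈ F := hF.mem_of_sum_mem (fun e => by
      by_cases he : e ∈ T
      · exact PointedCone.smul_mem _ (hc0 e) (vec_mem_cone α he)
      · rw [hc e he, zero_smul]
        exact Submodule.zero_mem _) hx d
    exact (PointedCone.smul_mem_iff F (lt_of_le_of_ne (hc0 d) (Ne.symm hne))).1 hterm
  · refine Submodule.span_le.2 ?_
    rintro _ ⟨d, hd, rfl⟩
    exact (Finset.mem_filter.1 hd).2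

theorem NonCrossing.exists_isTriangulation (hS : NonCrossing S) :
    ∃ T, S ⊆ T ∧ IsTriangulation T :=
  (Set.toFinite {T : Finset (PolygonDiagonal n) | NonCrossing T}).exists_le_maximal hS

theorem mem_seedFan_iff (hT₀ : IsTriangulation T₀) {F : PointedCone ℝ V} :
    F ∈ seedFan α ↔ ∃ S : Finset (PolygonDiagonal n), NonCrossing S ∧ F = cone α S := by
  constructor
  · rintro ⟨T, hT, hF⟩
    obtain ⟨S, hST, rfl⟩ := exists_eq_cone_of_isFaceOf α hF
    exact ⟨S, hT.prop.mono hST, rfl⟩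
  · rintro ⟨S, hS, rfl⟩
    obtain ⟨T, hST, hT⟩ := hS.exists_isTriangulation
    exact ⟨T, hT, cone_isFaceOf α hT₀ hT.prop hST⟩

/-- A common point has one compatible expansion, whose support lies in both `S` and `T`. -/
theorem cone_inf_cone (hT₀ : IsTriangulation T₀) (hS : NonCrossing S) (hT : NonCrossing T) :
    cone α S ⊓ cone α T = cone α (S ∩ T) := by
  refine le_antisymm ?_ (le_inf (cone_mono α Finset.inter_subset_left)
    (cone_mono α Finset.inter_subset_right))
  rintro x ⟨hx, hy⟩
  obtain ⟨a, ha0, ha, rfl⟩ := (mem_cone_iff α).1 hx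
  obtain ⟨b, hb0, hb, hab⟩ := (mem_cone_iff α).1 hy
  obtain rfl : b = a := IsCompatible.eq_of_comb_eq α hT₀
    (IsCompatible.of_noncrossing hT hb0 hb) (IsCompatible.of_noncrossing hS ha0 ha) hab
  refine (mem_cone_iff α).2 ⟨b, hb0, fun d hd => ?_, rfl⟩
  rw [Finset.mem_inter, not_and_or] at hd
  exact hd.elim (ha d) (hb d)

theorem subset_of_cone_le (hT₀ : IsTriangulation T₀) (hS : NonCrossing S) (hT : NonCrossing T)
    (h : cone α S ≤ cone α T) : S ⊆ T := by
  intro d hd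
  obtain ⟨c, hc0, hc, hcomb⟩ := (mem_cone_iff α).1 (h (vec_mem_cone α hd))
  have heq : c = Pi.single d 1 := IsCompatible.eq_of_comb_eq α hT₀
    (IsCompatible.of_noncrossing hT hc0 hc)
    (IsCompatible.of_noncrossing hS
      (Pi.single_nonneg.2 zero_le_one : 0 ≤ (Pi.single d 1 : PolygonDiagonal n → ℝ))
      fun e he => Pi.single_eq_of_ne (by rintro rfl; exact he hd) _)
    (hcomb.trans (comb_single α d).symm)
  by_contra hdT
  have h1 := hc d hdT
  rw [heq, Pi.single_eq_same] at h1
  exact one_ne_zero h1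

theorem isCompleteSimplicialFan_seedFan (hT₀ : IsTriangulation T₀) :
    IsCompleteSimplicialFan (seedFan α) := by
  refine ⟨⟨?_, ?_, ?_, ?_⟩, ?_, ?_⟩
  · refine (Set.finite_range (cone α)).subset fun F hF => ?_
    obtain ⟨S, _, rfl⟩ := (mem_seedFan_iff α hT₀).1 hF
    exact ⟨S, rfl⟩
  · intro C hC
    obtain ⟨S, _, rfl⟩ := (mem_seedFan_iff α hT₀).1 hC
    exact Submodule.fg_span (S.finite_toSet.image _)
  · rintro C ⟨T, hT, hC⟩ F hF
    exact ⟨T, hT, hF.trans hC⟩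
  · intro C hC D hD
    obtain ⟨S, hS, rfl⟩ := (mem_seedFan_iff α hT₀).1 hC
    obtain ⟨T, hT, rfl⟩ := (mem_seedFan_iff α hT₀).1 hD
    rw [cone_inf_cone α hT₀ hS hT]
    exact ⟨cone_isFaceOf α hT₀ hS Finset.inter_subset_left,
      cone_isFaceOf α hT₀ hT Finset.inter_subset_right⟩
  · intro C hC
    obtain ⟨S, hS, rfl⟩ := (mem_seedFan_iff α hT₀).1 hC
    have hli : LinearIndepOn ℝ (vec α) (S : Set (PolygonDiagonal n)) :=
      linearIndependent_vec α hT₀ hS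
    exact PointedCone.IsSimplicial.hull (S.finite_toSet.image _) hli.id_image
  · intro x
    classical
    obtain ⟨c, hc, rfl⟩ := exists_isCompatible α hT₀ x
    refine ⟨cone α (Finset.univ.filter fun d => 0 < c d), (mem_seedFan_iff α hT₀).2
      ⟨_, fun d hd e he => ?_, rfl⟩, (mem_cone_iff α).2 ⟨c, hc.nonneg, fun d hd => ?_, rfl⟩⟩
    · exact hc.not_crosses d e (Finset.mem_filter.1 hd).2 (Finset.mem_filter.1 he).2
    · refine le_antisymm (not_lt.1 fun h => hd ?_) (hc.nonneg d)
      exact Finset.mem_filter.2 ⟨Finset.mem_univ d, h⟩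

end linear

end PolygonDiagonal

theorem mainTheorem4 {n : ℕ} {V : Type*} [AddCommGroup V] [Module ℝ V]
    (T₀ : Finset (PolygonDiagonal n)) (hT₀ : PolygonDiagonal.IsTriangulation T₀)
    (α : Module.Basis T₀ ℝ V) :
    (∀ T : Finset (PolygonDiagonal n), PolygonDiagonal.IsTriangulation T →
      LinearIndependent ℝ (fun d : T => PolygonDiagonal.vec α d.1) ∧
      Submodule.span ℝ (PolygonDiagonal.vec α '' (T : Set (PolygonDiagonal n))) = ⊤) ∧
    Set.InjOn (PolygonDiagonal.cone α) {T | PolygonDiagonal.IsTriangulation T} ∧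
    IsCompleteSimplicialFan (PolygonDiagonal.seedFan α) :=
  ⟨fun _ hT => ⟨PolygonDiagonal.linearIndependent_vec α hT₀ hT.prop,
      PolygonDiagonal.span_vec α hT₀ hT⟩,
    fun _ hS _ hT h => Finset.Subset.antisymm
      (PolygonDiagonal.subset_of_cone_le α hT₀ hS.prop hT.prop h.le)
      (PolygonDiagonal.subset_of_cone_le α hT₀ hT.prop hS.prop h.ge),
    PolygonDiagonal.isCompleteSimplicialFan_seedFan α hT₀⟩
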